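/- **Setting.** Let $\mathcal A$ be a finite set of arms and $\overline\Omega\subset\mathbb R$ a finite set of outcomes. A *strategy* $s=(s_i)_{i\ge 1}$ chooses the arm at stage $i$ as $a_i=s_i(a^{(i-1)},\omega^{(i-1)})\in\mathcal A$, a function of the past arms $a^{(i-1)}=(a_1,\dots,a_{i-1})$ and past outcomes $\omega^{(i-1)}=(\omega_1,\dots,\omega_{i-1})$; $\mathcal S$ is the set of all strategies. *Beliefs* assign to every stage $i\ge1$, every history $(a^{(i-1)},\omega^{(i-1)})\in\mathcal A^{i-1}\times\overline\Omega^{\,i-1}$ and every arm $a$ a probability law on $\overline\Omega$ for the next outcome. For $s\in\mathcal S$, let $P^s$ be the probability measure on $\overline\Omega^{\,\infty}$ obtained by pasting together (Ionescu-Tulcea) the conditional laws of the arms that $s$ chooses, and let $X_i(\omega)=\omega_i$. Let $0<\underline\sigma<\overline\sigma$. Call beliefs *admissible* (with extremes $\underline\sigma,\overline\sigma$) if, at every stage and every history, each arm's law has full support on $\overline\Omega$ and mean $0$, and the largest and the smallest variance across arms are $\overline\sigma^2$ and $\underline\sigma^2$, respectively. Let $\theta=\underline\sigma/\overline\sigma$,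 $c\in\mathbb R$, and let $\varphi_1:[0,\infty)\to\mathbb R$ be three times continuously differentiable with bounded third derivative, strictly increasing, strictly concave, with $\varphi_1(0)=0$. Define $$\varphi(x)=\begin{cases}\varphi_1(x-c), & x\ge c,\\ -\theta^{-1}\varphi_1(-\theta(x-c)), & x<c,\end{cases}\qquad V_n=\sup_{s\in\mathcal S}E_{P^s}\Big[\varphi\Big(\tfrac1{\sqrt n}\sum_{i=1}^nX_i\Big)\Big].$$ Put $\kappa=\frac{\overline\sigma-\underline\sigma}{\overline\sigma+\underline\sigma}$ and define $q$ as follows. For $c\ge0$, $$q(y)=\begin{cases}\frac{1}{\underline\sigma\sqrt{2\pi}}\Big(e^{-\frac12\left(-\frac{c}{\overline\sigma}-\frac{y-c}{\underline\sigma}\right)^2}+\kappa\, e^{-\frac12\left(\frac{c}{\overline\sigma}+\frac{y-c}{\underline\sigma}\right)^2}\Big), & y\ge c,\\[1ex] \frac{1}{\overline\sigma\sqrt{2\pi}}\Big(e^{-\frac12\left(-\frac{c}{\overline\sigma}-\frac{y-c}{\overline\sigma}\right)^2}-\kappa\, e^{-\frac12\left(\frac{c}{\overline\sigma}+\frac{c-y}{\overline\sigma}\right)^2}\Big),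 & y<c,\end{cases}$$ and for $c<0$, $$q(y)=\begin{cases}\frac{1}{\underline\sigma\sqrt{2\pi}}\Big(e^{-\frac12\left(-\frac{c}{\underline\sigma}-\frac{y-c}{\underline\sigma}\right)^2}+\kappa\, e^{-\frac12\left(-\frac{c}{\underline\sigma}+\frac{y-c}{\underline\sigma}\right)^2}\Big), & y\ge c,\\[1ex] \frac{1}{\overline\sigma\sqrt{2\pi}}\Big(e^{-\frac12\left(-\frac{c}{\underline\sigma}-\frac{y-c}{\overline\sigma}\right)^2}-\kappa\, e^{-\frac12\left(-\frac{c}{\underline\sigma}+\frac{c-y}{\overline\sigma}\right)^2}\Big), & y<c.\end{cases}$$ **Theorem.** For admissible beliefs, each $V_n$ is a finite supremum, $q$ is a probability density, $\varphi q$ is integrable, and the following hold. (i) The limit $V=\lim_{n\to\infty}V_n$ exists and $V=\int_{-\infty}^{\infty}\varphi(y)q(y)\,dy$. For $c=0$, $$q(y)=\begin{cases}q^*(y;\underline\sigma)\,\frac{2\overline\sigma}{\underline\sigma+\overline\sigma}, & y\ge0,\\ q^*(y;\overline\sigma)\,\frac{2\underline\sigma}{\underline\sigma+\overline\sigma}, &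 y<0,\end{cases}\qquad q^*(y;\sigma)=\frac1{\sqrt{2\pi}\,\sigma}e^{-(y/\sigma)^2/2}.$$ (ii) If the beliefs are replaced by any other admissible beliefs with the same extremes $\underline\sigma,\overline\sigma$, then the limit $V$ is the same. (iii) $V=\varphi(0)$ if $c=0$, $V>\varphi(0)$ if $c>0$, and $V<\varphi(0)$ if $c<0$. -/

import Mathlib

open MeasureTheory ProbabilityTheory Filter Topology

/-- A strategy for the infinite horizon: at stage `i` (stages are numbered from `0`) an arm is
chosen as a function of the `i` previous arms and the `i` previous outcomes. -/
abbrev Strategy (A : Type*) (Ω : Finset ℝ) : Type _ :=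
  (i : ℕ) → (Fin i → A) → (Fin i → Ω) → A

/-- The sequence of the first `n` arms that the strategy `s` chooses along the outcome history
`ω`, obtained by iterating the stage strategies. -/
def armHistory {A : Type*} {Ω : Finset ℝ} (s : Strategy A Ω) :
    (n : ℕ) → (Fin n → Ω) → (Fin n → A)
  | 0, _ => Fin.elim0
  | n + 1, ω =>
    Fin.snoc (α := fun _ => A) (armHistory s n (Fin.init ω))
      (s n (armHistory s n (Fin.init ω)) (Fin.init ω))

/-- Primitive one-step-ahead beliefs: for every stage, every history of past arms and past
outcomes, and every arm, the probability law of the next outcome of that arm. -/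
abbrev Beliefs (A : Type*) (Ω : Finset ℝ) : Type _ :=
  (i : ℕ) → (Fin i → A) → (Fin i → Ω) → A → ProbabilityMeasure Ω

/-- The standing assumptions on beliefs: at every stage and after every history each arm has full
support on the outcome set and mean zero, and the largest and smallest variances across arms are
`σhi ^ 2` and `σlo ^ 2`. -/
structure Beliefs.Admissible {A : Type*} {Ω : Finset ℝ} (B : Beliefs A Ω) (σlo σhi : ℝ) :
    Prop where
  full_support : ∀ i (a : Fin i → A) (ω : Fin i → Ω) (b : A) (x : Ω),
    (B i a ω b : Measure Ω) {x} ≠ 0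
  mean_zero : ∀ i (a : Fin i → A) (ω : Fin i → Ω) (b : A),
    ∫ x, (x : ℝ) ∂(B i a ω b : Measure Ω) = 0
  max_variance : ∀ i (a : Fin i → A) (ω : Fin i → Ω),
    IsGreatest (Set.range fun b : A => ∫ x, (x : ℝ) ^ 2 ∂(B i a ω b : Measure Ω)) (σhi ^ 2)
  min_variance : ∀ i (a : Fin i → A) (ω : Fin i → Ω),
    IsLeast (Set.range fun b : A => ∫ x, (x : ℝ) ^ 2 ∂(B i a ω b : Measure Ω)) (σlo ^ 2)

/-- The law of the outcome at stage `n` given the outcome history `ω`, under the strategy `s`: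
the past arms are the ones that `s` has chosen along `ω`. -/
def stageLaw {A : Type*} {Ω : Finset ℝ} (B : Beliefs A Ω) (s : Strategy A Ω)
    (n : ℕ) (ω : Fin n → Ω) : Measure Ω :=
  B n (armHistory s n ω) ω (s n (armHistory s n ω) ω)

/-- The same conditional law for stage `n + 1`, as a Markov kernel on the coordinates
`0, …, n`. -/
noncomputable def stageKernel {A : Type*} {Ω : Finset ℝ} (B : Beliefs A Ω) (s : Strategy A Ω)
    (n : ℕ) : Kernel ((_ : Finset.Iic n) → Ω) Ω :=
  Kernel.ofFunOfCountable fun x =>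
    stageLaw B s (n + 1) fun k => x ⟨k, Finset.mem_Iic.2 (Nat.lt_succ_iff.1 k.isLt)⟩

instance {A : Type*} {Ω : Finset ℝ} (B : Beliefs A Ω) (s : Strategy A Ω) (n : ℕ) :
    IsMarkovKernel (stageKernel B s n) :=
  ⟨fun x => by
    change IsProbabilityMeasure (stageLaw B s (n + 1) _)
    unfold stageLaw
    infer_instance⟩

/-- The measure on infinite outcome sequences induced by the strategy `s`: the one-step-ahead laws
pasted together by the Ionescu-Tulcea theorem. -/
noncomputable def outcomeLaw {A : Type*} {Ω : Finset ℝ} (B : Beliefs A Ω) (s : Strategy A Ω) :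
    Measure (ℕ → Ω) :=
  Kernel.trajMeasure (X := fun _ => Ω) (stageLaw B s 0 Fin.elim0) (stageKernel B s)

/-- Expected utility of the strategy `s` over the horizon `n`. -/
noncomputable def expectedUtility {A : Type*} {Ω : Finset ℝ} (B : Beliefs A Ω) (φ : ℝ → ℝ)
    (n : ℕ) (s : Strategy A Ω) : ℝ :=
  ∫ ω, φ ((∑ i ∈ Finset.range n, (ω i : ℝ)) / √n) ∂(outcomeLaw B s)

/-- The value of the `n`-horizon problem. -/
noncomputable def value {A : Type*} {Ω : Finset ℝ} (B : Beliefs A Ω) (φ : ℝ → ℝ) (n : ℕ) : ℝ :=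
  ⨆ s : Strategy A Ω, expectedUtility B φ n s

/-- The loss averse utility index with reference point `c`, gain function `φ₁` and
parameter `θ`. -/
noncomputable def utilityIndex (φ₁ : ℝ → ℝ) (θ c x : ℝ) : ℝ :=
  if c ≤ x then φ₁ (x - c) else -θ⁻¹ * φ₁ (-θ * (x - c))

/-- The assumptions on the gain function, which matters only on `[0, ∞)`. -/
structure IsGainFunction (φ₁ : ℝ → ℝ) : Prop where
  zero : φ₁ 0 = 0
  contDiffOn : ContDiffOn ℝ 3 φ₁ (Set.Ici 0)
  bounded_third : ∃ M : ℝ, ∀ x ∈ Set.Ici (0 : ℝ),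
    |iteratedDerivWithin 3 φ₁ (Set.Ici 0) x| ≤ M
  strictMonoOn : StrictMonoOn φ₁ (Set.Ici 0)
  strictConcaveOn : StrictConcaveOn ℝ (Set.Ici 0) φ₁

/-- The density of the normal distribution with mean `0` and standard deviation `σ`. -/
noncomputable def normalDensity (σ y : ℝ) : ℝ :=
  1 / (√(2 * Real.pi) * σ) * Real.exp (-(y / σ) ^ 2 / 2)

/-- The limiting density (the law at time `1` of the oscillating Brownian motion with threshold
`c` that starts at `0`). -/
noncomputable def limitDensity (σlo σhi c y : ℝ) : ℝ :=
  if 0 ≤ c then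
    if c ≤ y then
      1 / (σlo * √(2 * Real.pi)) *
        (Real.exp (-(-c / σhi - (y - c) / σlo) ^ 2 / 2)
          + (σhi - σlo) / (σlo + σhi) * Real.exp (-(c / σhi + (y - c) / σlo) ^ 2 / 2))
    else
      1 / (σhi * √(2 * Real.pi)) *
        (Real.exp (-(-c / σhi - (y - c) / σhi) ^ 2 / 2)
          - (σhi - σlo) / (σlo + σhi) * Real.exp (-(c / σhi + (c - y) / σhi) ^ 2 / 2))
  else
    if c ≤ y then
      1 / (σlo * √(2 * Real.pi)) *
        (Real.exp (-(-c / σlo - (y - c) / σlo) ^ 2 / 2)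
          + (σhi - σlo) / (σlo + σhi) * Real.exp (-(-c / σlo + (y - c) / σlo) ^ 2 / 2))
    else
      1 / (σhi * √(2 * Real.pi)) *
        (Real.exp (-(-c / σlo - (y - c) / σhi) ^ 2 / 2)
          - (σhi - σlo) / (σlo + σhi) * Real.exp (-(-c / σlo + (c - y) / σhi) ^ 2 / 2))

/-!
The limit problem is solved in closed form, so that the discrete problem can be compared with it
directly, without stochastic differential equations or viscosity solutions.

Write `h` for the odd extension of `z ↦ φ₁ (σlo * z)`. In the normalized coordinates
`z = (x - c) / σlo` above the threshold and `z = (x - c) / σhi` below it, the utility index is `h`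
above and `(σhi / σlo) * h` below: this is `glue`, and `utilityIndex_eq_glue` says that the index is
the glued profile. The heat semigroup `heat` keeps a profile odd and keeps its second derivative
nonpositive on `[0, ∞)` (`heat_nonpos`). Hence the glued heat flow is continuously differentiable at
the threshold, its second derivative vanishes there, it is concave above and convex below, and so it
solves the Hamilton-Jacobi-Bellman equation of the limit problem: the low variance is optimal above
`c` and the high variance below.

A Lindeberg-type comparison, stage by stage, bounds the expected utility of every strategy by the
glued heat flow, with equality up to `O(n ^ (-1/2))` for the strategy that always takes the arm of
optimal variance (`integral_glue_succ_le`, `le_integral_glue_succ`, `expectedUtility_glue_bounds`).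
Each stage needs a second-order expansion with a uniform cubic error. It holds once `h` has been
replaced by its double average over small intervals (`OddConcave.exists_oddJet`), which moves all
values by a uniformly small amount; gluing preserves it (`exists_abs_glue_taylor_le`). Letting the
smoothing tend to zero gives `tendsto_value_glue`: the values converge to the glued heat flow of `h`
at time `1`, started at `0`.

This limit depends on the beliefs through `σlo` and `σhi` only. Folding the two branches of the
limiting density onto a half-line identifies it with the integral of the utility index against that
density (`integrable_and_integral_glue_mul_limitDensity`). Finally, by oddness and strict concavity
`h (a + y) + h (a - y) < 2 * h a` for `a > 0` and `y ≠ 0`, so that `heat 1 h a < h a`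
(`OddConcave.heat_lt`), which gives the sign of the limit minus the utility of `0`.
-/

open scoped NNReal

/-! ### Odd functions concave on the half-line -/

/-- The profile of a gain function in normalized coordinates: an odd, globally Lipschitz function
that is strictly concave on the half-line `[0, ∞)`. -/
structure OddConcave (h : ℝ → ℝ) (L : ℝ) : Prop where
  odd : ∀ z, h (-z) = -h z
  strictConcaveOn : StrictConcaveOn ℝ (Set.Ici 0) h
  lipschitz : ∀ x y, |h x - h y| ≤ L * |x - y|

theorem continuous_of_abs_sub_le {f : ℝ → ℝ} {L : ℝ}
    (hf : ∀ x y, |f x - f y| ≤ L * |x - y|) : Continuous f := by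
  refine (LipschitzWith.of_dist_le_mul (K := L.toNNReal) fun x y => ?_).continuous
  rw [Real.dist_eq, Real.dist_eq]
  exact (hf x y).trans (mul_le_mul_of_nonneg_right (Real.le_coe_toNNReal L) (abs_nonneg _))

theorem eq_zero_of_odd {f : ℝ → ℝ} (hf : ∀ z, f (-z) = -f z) : f 0 = 0 := by
  have := hf 0
  rw [neg_zero] at this
  linarith

namespace OddConcave

variable {h : ℝ → ℝ} {L : ℝ}

theorem nonneg (hh : OddConcave h L) : 0 ≤ L := by
  have := (abs_nonneg _).trans (hh.lipschitz 1 0)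
  simpa using this

theorem continuous (hh : OddConcave h L) : Continuous h :=
  continuous_of_abs_sub_le hh.lipschitz

/-- The symmetric second differences at `a > 0` are negative, even when the step `y` reaches past
the origin: there oddness turns the claim into subadditivity of a concave function. -/
theorem add_sub_lt_two_mul (hh : OddConcave h L) {a y : ℝ} (ha : 0 < a) (hy : y ≠ 0) :
    h (a + y) + h (a - y) < 2 * h a := by
  have key : ∀ y, 0 < y → h (a + y) + h (a - y) < 2 * h a := by
    intro y hy
    have h0 : h 0 = 0 := eq_zero_of_odd hh.odd
    have mid : ∀ u v : ℝ, 0 ≤ u → 0 ≤ v → u ≠ v → h u + h v < 2 * h ((u + v) / 2) := by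
      intro u v hu hv huv
      have := hh.strictConcaveOn.2 (Set.mem_Ici.2 hu) (Set.mem_Ici.2 hv) huv
        (show (0 : ℝ) < 1 / 2 by norm_num) (show (0 : ℝ) < 1 / 2 by norm_num) (by norm_num)
      simp only [smul_eq_mul] at this
      rw [show 1 / 2 * u + 1 / 2 * v = (u + v) / 2 by ring] at this
      linarith
    rcases le_or_gt y a with hya | hya
    · have := mid (a + y) (a - y) (by linarith) (by linarith) (by intro h; linarith)
      rwa [show (a + y + (a - y)) / 2 = a by ring] at this
    · have hs : 0 < a + y := by linarith
      have h1 := hh.strictConcaveOn.2 (Set.mem_Ici.2 le_rfl) (Set.mem_Ici.2 hs.le) hs.ne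
        (show 0 < (y - a) / (a + y) by apply div_pos <;> linarith)
        (show 0 < 2 * a / (a + y) by positivity) (by field_simp; ring)
      have h2 := hh.strictConcaveOn.2 (Set.mem_Ici.2 le_rfl) (Set.mem_Ici.2 hs.le) hs.ne
        (show 0 < 2 * a / (a + y) by positivity)
        (show 0 < (y - a) / (a + y) by apply div_pos <;> linarith) (by field_simp; ring)
      have h3 := mid 0 (2 * a) le_rfl (by linarith) (by linarith)
      simp only [smul_eq_mul, mul_zero, zero_add, h0] at h1 h2 h3
      rw [div_mul_cancel₀ _ hs.ne'] at h1 h2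
      rw [mul_div_cancel_left₀ _ (two_ne_zero' ℝ)] at h3
      have h4 : 2 * a / (a + y) * h (a + y) + (y - a) / (a + y) * h (a + y) = h (a + y) := by
        field_simp
        ring
      have h5 := hh.odd (y - a)
      rw [neg_sub] at h5
      linarith
  rcases lt_or_gt_of_ne hy with hy | hy
  · have := key (-y) (by linarith)
    rw [sub_neg_eq_add, ← sub_eq_add_neg] at this
    linarith
  · exact key y hy

theorem add_sub_le_two_mul (hh : OddConcave h L) {a : ℝ} (ha : 0 ≤ a) (y : ℝ) :
    h (a + y) + h (a - y) ≤ 2 * h a := by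
  rcases ha.eq_or_lt with rfl | ha
  · have := hh.odd y
    rw [zero_add, zero_sub, eq_zero_of_odd hh.odd]
    linarith
  · rcases eq_or_ne y 0 with rfl | hy
    · rw [add_zero, sub_zero]
      linarith
    · exact (hh.add_sub_lt_two_mul ha hy).le

end OddConcave

/-- The odd function that agrees with `f` on `[0, ∞)`, for `f 0 = 0`. -/
noncomputable def oddExtension (f : ℝ → ℝ) (z : ℝ) : ℝ :=
  if 0 ≤ z then f z else -f (-z)

theorem oddExtension_neg {f : ℝ → ℝ} (h0 : f 0 = 0) (z : ℝ) :
    oddExtension f (-z) = -oddExtension f z := by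
  unfold oddExtension
  rcases lt_trichotomy z 0 with hz | rfl | hz
  · rw [if_pos (by linarith), if_neg (by linarith)]
    ring
  · simp [h0]
  · rw [if_neg (by linarith), if_pos hz.le, neg_neg]

/-- A gain function is Lipschitz: its slopes lie between `0` and the one-sided derivative at the
origin. -/
theorem IsGainFunction.exists_lipschitz {φ₁ : ℝ → ℝ} (h : IsGainFunction φ₁) :
    ∃ L : ℝ, 0 ≤ L ∧ ∀ x y, 0 ≤ x → 0 ≤ y → |φ₁ x - φ₁ y| ≤ L * |x - y| := by
  have hd : DifferentiableWithinAt ℝ φ₁ (Set.Ici 0) 0 :=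
    (h.contDiffOn.differentiableOn (by norm_num)) 0 (Set.mem_Ici.2 le_rfl)
  set L := derivWithin φ₁ (Set.Ici 0) 0
  have hL : HasDerivWithinAt φ₁ L (Set.Ici 0) 0 := hd.hasDerivWithinAt
  have h0 : ∀ y, 0 < y → φ₁ y ≤ L * y := by
    intro y hy
    have := h.strictConcaveOn.concaveOn.slope_le_of_hasDerivWithinAt (Set.mem_Ici.2 le_rfl)
      (Set.mem_Ici.2 hy.le) hy hL
    rw [slope_def_field, h.zero, sub_zero, sub_zero, div_le_iff₀ hy] at this
    exact this
  have key : ∀ x y, 0 ≤ x → x < y → |φ₁ y - φ₁ x| ≤ L * |y - x| := by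
    intro x y hx hxy
    have hm := h.strictMonoOn (Set.mem_Ici.2 hx) (Set.mem_Ici.2 (hx.trans hxy.le)) hxy
    rw [abs_of_pos (sub_pos.2 hm), abs_of_pos (sub_pos.2 hxy)]
    refine le_trans ?_ (h0 (y - x) (sub_pos.2 hxy))
    rcases hx.eq_or_lt with rfl | hx
    · rw [h.zero, sub_zero, sub_zero]
    have hy : 0 < y := hx.trans hxy
    have c := h.strictConcaveOn.concaveOn.2
    have h1 := c (Set.mem_Ici.2 le_rfl) (Set.mem_Ici.2 hy.le)
      (show 0 ≤ (y - x) / y from div_nonneg (by linarith) hy.le)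
      (show 0 ≤ x / y by positivity) (by field_simp; ring)
    have h2 := c (Set.mem_Ici.2 le_rfl) (Set.mem_Ici.2 hy.le)
      (show 0 ≤ x / y by positivity)
      (show 0 ≤ (y - x) / y from div_nonneg (by linarith) hy.le) (by field_simp; ring)
    simp only [smul_eq_mul, mul_zero, zero_add, h.zero] at h1 h2
    rw [div_mul_cancel₀ _ hy.ne'] at h1 h2
    have h4 : x / y * φ₁ y + (y - x) / y * φ₁ y = φ₁ y := by
      field_simp
      ring
    linarith
  refine ⟨L, ?_, fun x y hx hy => ?_⟩
  · have := (abs_nonneg _).trans (key 0 1 le_rfl one_pos)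
    simpa using this
  · rcases lt_trichotomy x y with hxy | rfl | hxy
    · rw [abs_sub_comm, abs_sub_comm x]
      exact key x y hx hxy
    · simp
    · exact key y x hy hxy

theorem oddConcave_oddExtension {φ₁ : ℝ → ℝ} (h : IsGainFunction φ₁) {σ : ℝ} (hσ : 0 < σ) :
    ∃ L, OddConcave (oddExtension fun z => φ₁ (σ * z)) L := by
  obtain ⟨L, hL, hl⟩ := h.exists_lipschitz
  have hodd := oddExtension_neg (f := fun z => φ₁ (σ * z)) (by simp [h.zero])
  have hpos : ∀ z, 0 ≤ z → oddExtension (fun z => φ₁ (σ * z)) z = φ₁ (σ * z) :=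
    fun z hz => if_pos hz
  have hneg : ∀ z, z ≤ 0 → oddExtension (fun z => φ₁ (σ * z)) z = -φ₁ (σ * -z) := by
    intro z hz
    rw [← hpos (-z) (by linarith), hodd, neg_neg]
  have habs : ∀ z, 0 ≤ z → |φ₁ z| ≤ L * z := by
    intro z hz
    have := hl z 0 hz le_rfl
    rwa [h.zero, sub_zero, sub_zero, abs_of_nonneg hz] at this
  refine ⟨L * σ, hodd, ⟨convex_Ici 0, ?_⟩, ?_⟩
  · intro x hx y hy hxy a b ha hb hab
    rw [Set.mem_Ici] at hx hy
    have := h.strictConcaveOn.2 (x := σ * x) (Set.mem_Ici.2 (by positivity)) (y := σ * y)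
      (Set.mem_Ici.2 (by positivity)) (fun h => hxy (mul_left_cancel₀ hσ.ne' h)) ha hb hab
    simp only [smul_eq_mul] at this ⊢
    rw [hpos x hx, hpos y hy, hpos _ (by positivity)]
    convert this using 2
    ring
  · intro x y
    have hs : ∀ u v : ℝ, |σ * u - σ * v| = σ * |u - v| := fun u v => by
      rw [← mul_sub, abs_mul, abs_of_pos hσ]
    have hmix : ∀ u v : ℝ, 0 ≤ u → 0 ≤ v → |φ₁ (σ * u) + φ₁ (σ * v)| ≤ L * σ * (u + v) := by
      intro u v hu hv
      refine (abs_add_le _ _).trans ?_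
      have h1 := habs (σ * u) (by positivity)
      have h2 := habs (σ * v) (by positivity)
      linarith
    rcases le_total 0 x with hx | hx <;> rcases le_total 0 y with hy | hy
    · rw [hpos x hx, hpos y hy]
      have := hl (σ * x) (σ * y) (by positivity) (by positivity)
      rwa [hs, ← mul_assoc] at this
    · rw [hpos x hx, hneg y hy, sub_neg_eq_add, abs_of_nonneg (by linarith : 0 ≤ x - y)]
      exact hmix x (-y) hx (by linarith)
    · rw [hneg x hx, hpos y hy, abs_of_nonpos (by linarith : x - y ≤ 0), ← abs_neg]
      have := hmix (-x) y (by linarith) hy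
      convert this using 2 <;> ring
    · rw [hneg x hx, hneg y hy]
      have := hl (σ * -y) (σ * -x) (mul_nonneg hσ.le (by linarith))
        (mul_nonneg hσ.le (by linarith))
      rw [hs, ← mul_assoc] at this
      convert this using 2
      · ring_nf
      · ring_nf

/-! ### Averaging over intervals -/

/-- The average of `f` over the interval of radius `δ` around `z`. -/
noncomputable def boxAverage (δ : ℝ) (f : ℝ → ℝ) (z : ℝ) : ℝ :=
  (2 * δ)⁻¹ * ∫ y in (-δ)..δ, f (z + y)

section BoxAverage

variable {f : ℝ → ℝ} {δ L : ℝ}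

theorem boxAverage_neg (hf : ∀ z, f (-z) = -f z) (z : ℝ) :
    boxAverage δ f (-z) = -boxAverage δ f z := by
  unfold boxAverage
  have : ∀ y, f (-z + y) = -f (z + -y) := fun y => by rw [← hf]; ring_nf
  simp_rw [this]
  rw [intervalIntegral.integral_neg, intervalIntegral.integral_comp_neg (fun y => f (z + y)),
    neg_neg]
  ring

theorem hasDerivAt_boxAverage (hf : Continuous f) (z : ℝ) :
    HasDerivAt (boxAverage δ f) ((2 * δ)⁻¹ * (f (z + δ) - f (z - δ))) z := by
  have h1 : boxAverage δ f = fun z => (2 * δ)⁻¹ *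
      ((∫ y in (0 : ℝ)..(z + δ), f y) - ∫ y in (0 : ℝ)..(z - δ), f y) := by
    funext z
    unfold boxAverage
    rw [intervalIntegral.integral_comp_add_left, intervalIntegral.integral_interval_sub_left
      (hf.intervalIntegrable _ _) (hf.intervalIntegrable _ _), ← sub_eq_add_neg]
  rw [h1]
  refine HasDerivAt.const_mul _ (HasDerivAt.sub ?_ ?_)
  · exact (intervalIntegral.integral_hasDerivAt_right (hf.intervalIntegrable _ _)
      (hf.stronglyMeasurableAtFilter _ _) hf.continuousAt).comp_add_const z δ
  · exact (intervalIntegral.integral_hasDerivAt_right (hf.intervalIntegrable _ _)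
      (hf.stronglyMeasurableAtFilter _ _) hf.continuousAt).comp_sub_const z δ

theorem abs_boxAverage_sub_le (hδ : 0 < δ) {g : ℝ → ℝ} (hf : Continuous f) (hg : Continuous g)
    {C z w : ℝ} (h : ∀ y, |y| ≤ δ → |f (z + y) - g (w + y)| ≤ C) :
    |boxAverage δ f z - boxAverage δ g w| ≤ C := by
  unfold boxAverage
  rw [← mul_sub, ← intervalIntegral.integral_sub
    (by apply Continuous.intervalIntegrable; fun_prop)
    (by apply Continuous.intervalIntegrable; fun_prop), abs_mul, abs_of_pos (by positivity)]
  have := intervalIntegral.norm_integral_le_of_norm_le_const (a := -δ) (b := δ) (C := C)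
    (f := fun y => f (z + y) - g (w + y)) (fun y hy => by
      rw [Set.uIoc_of_le (by linarith)] at hy
      exact h y (abs_le.2 ⟨hy.1.le, hy.2⟩))
  rw [Real.norm_eq_abs, sub_neg_eq_add, abs_of_pos (by linarith : 0 < δ + δ)] at this
  rw [inv_mul_le_iff₀ (by positivity)]
  linarith

theorem boxAverage_lipschitz (hδ : 0 < δ) (hf : ∀ x y, |f x - f y| ≤ L * |x - y|) (x y : ℝ) :
    |boxAverage δ f x - boxAverage δ f y| ≤ L * |x - y| := by
  have hc := continuous_of_abs_sub_le hf
  refine abs_boxAverage_sub_le hδ hc hc fun u _ => ?_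
  simpa using hf (x + u) (y + u)

theorem abs_boxAverage_sub_self_le (hδ : 0 < δ) (hL : 0 ≤ L)
    (hf : ∀ x y, |f x - f y| ≤ L * |x - y|) (z : ℝ) :
    |boxAverage δ f z - f z| ≤ L * δ := by
  have hc := continuous_of_abs_sub_le hf
  have h1 : boxAverage δ (fun _ => f z) 0 = f z := by
    unfold boxAverage
    rw [intervalIntegral.integral_const, smul_eq_mul]
    field_simp
    ring
  have := abs_boxAverage_sub_le (z := z) (w := 0) (C := L * δ) hδ hc
    (continuous_const (y := f z)) fun y hy => by
      refine (hf _ _).trans ?_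
      rw [add_sub_cancel_left]
      gcongr
  rwa [h1] at this

end BoxAverage

/-! ### Second-order expansions -/

/-- An odd function `f` with a second-order expansion at every point, with coefficients `f₁`, `f₂`
and a uniform cubic error bound, whose second-order coefficient is odd and nonpositive on
`[0, ∞)`. Working with the expansion itself avoids differentiating under integral signs. -/
structure OddJet (f f₁ f₂ : ℝ → ℝ) (K : ℝ) : Prop where
  odd : ∀ z, f (-z) = -f z
  odd_second : ∀ z, f₂ (-z) = -f₂ z
  second_nonpos : ∀ z, 0 ≤ z → f₂ z ≤ 0
  taylor : ∀ z y, |f (z + y) - f z - f₁ z * y - f₂ z / 2 * y ^ 2| ≤ K * |y| ^ 3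

theorem OddJet.nonneg {f f₁ f₂ : ℝ → ℝ} {K : ℝ} (h : OddJet f f₁ f₂ K) : 0 ≤ K := by
  simpa using (abs_nonneg _).trans (h.taylor 0 1)

theorem abs_taylor_two_le {f f₁ f₂ : ℝ → ℝ} {K : ℝ} (hf : ∀ z, HasDerivAt f (f₁ z) z)
    (hf₁ : ∀ z, HasDerivAt f₁ (f₂ z) z) (hf₂ : ∀ x y, |f₂ x - f₂ y| ≤ K * |x - y|) (z y : ℝ) :
    |f (z + y) - f z - f₁ z * y - f₂ z / 2 * y ^ 2| ≤ K * |y| ^ 3 := by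
  have hK : 0 ≤ K := by simpa using (abs_nonneg _).trans (hf₂ 1 0)
  -- both steps bound the increment over `[0, y]` of a function with small derivative
  have step : ∀ (r r' : ℝ → ℝ) (C : ℝ), (∀ t, HasDerivAt r (r' t) t) →
      (∀ t, |t| ≤ |y| → |r' t| ≤ C) → ∀ t, |t| ≤ |y| → |r t - r 0| ≤ C * |t| := by
    intro r r' C hr hC t ht
    have := (convex_Icc (-|y|) |y|).norm_image_sub_le_of_norm_hasDerivWithin_le (f := r) (f' := r')
      (C := C) (fun u _ => (hr u).hasDerivWithinAt) (fun u hu => hC u (abs_le.2 hu))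
      (x := 0) (y := t) (Set.mem_Icc.2 (by simp)) (abs_le.1 ht)
    simpa using this
  have h1 : ∀ t, |t| ≤ |y| → |f₁ (z + t) - f₁ z - f₂ z * t| ≤ K * |y| * |y| := by
    intro t ht
    have := step (fun t => f₁ (z + t) - f₁ z - f₂ z * t) (fun t => f₂ (z + t) - f₂ z) (K * |y|)
      (fun t => by
        refine ((((hf₁ (z + t)).comp_const_add z t).sub_const (f₁ z)).sub
          ((hasDerivAt_id t).const_mul (f₂ z))).congr_deriv ?_
        simp)
      (fun t ht => by
        refine (hf₂ _ _).trans ?_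
        rw [add_sub_cancel_left]
        gcongr) t ht
    simp only [add_zero, sub_self, mul_zero, sub_zero] at this
    exact this.trans (by gcongr)
  have := step (fun t => f (z + t) - f z - f₁ z * t - f₂ z / 2 * t ^ 2)
    (fun t => f₁ (z + t) - f₁ z - f₂ z * t) (K * |y| * |y|)
    (fun t => by
      have := ((((hf (z + t)).comp_const_add z t).sub_const (f z)).sub
        ((hasDerivAt_id t).const_mul (f₁ z))).sub (((hasDerivAt_id t).pow 2).const_mul (f₂ z / 2))
      refine this.congr_deriv ?_
      simp
      ring) h1 y le_rfl
  simp only [add_zero, sub_self, mul_zero, sub_zero, ne_eq, OfNat.ofNat_ne_zero,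
    not_false_eq_true, zero_pow] at this
  calc _ ≤ K * |y| * |y| * |y| := this
    _ = K * |y| ^ 3 := by ring

/-- Averaging twice over small intervals turns an odd Lipschitz function, concave on the half-line,
into a twice differentiable one of the same shape: its second derivative is a second difference
quotient, hence nonpositive on `[0, ∞)`, bounded and Lipschitz. -/
theorem OddConcave.exists_oddJet {h : ℝ → ℝ} {L : ℝ} (hh : OddConcave h L) {δ : ℝ} (hδ : 0 < δ) :
    ∃ (g g₁ g₂ : ℝ → ℝ) (K M : ℝ), OddJet g g₁ g₂ K ∧ (∀ x y, |g x - g y| ≤ L * |x - y|) ∧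
      (∀ z, |g z - h z| ≤ 2 * L * δ) ∧ Continuous g₁ ∧ Continuous g₂ ∧
      (∀ z, |g₁ z| ≤ M) ∧ ∀ z, |g₂ z| ≤ M := by
  have hL := hh.nonneg
  have hc := hh.continuous
  have hA := boxAverage_lipschitz hδ hh.lipschitz
  have hAc := continuous_of_abs_sub_le hA
  set A := boxAverage δ h with hAdef
  set D := (2 * δ)⁻¹ with hD
  have hD0 : 0 < D := by positivity
  let g₁ : ℝ → ℝ := fun z => D * (A (z + δ) - A (z - δ))
  let g₂ : ℝ → ℝ := fun z => D * (D * (h (z + δ + δ) - h (z + δ - δ))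
    - D * (h (z - δ + δ) - h (z - δ - δ)))
  have hg₂ : ∀ z, g₂ z = D * D * (h (z + 2 * δ) + h (z - 2 * δ) - 2 * h z) := by
    intro z
    simp only [g₂]
    rw [show z + δ + δ = z + 2 * δ by ring, show z + δ - δ = z by ring,
      show z - δ + δ = z by ring, show z - δ - δ = z - 2 * δ by ring]
    ring
  have hd : ∀ z, HasDerivAt (boxAverage δ A) (g₁ z) z := hasDerivAt_boxAverage hAc
  have hd₁ : ∀ z, HasDerivAt g₁ (g₂ z) z := fun z =>
    (((hasDerivAt_boxAverage hc (z + δ)).comp_add_const z δ).sub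
      ((hasDerivAt_boxAverage hc (z - δ)).comp_sub_const z δ)).const_mul D
  have hlip₂ : ∀ x y, |g₂ x - g₂ y| ≤ (4 * D * D * L) * |x - y| := by
    intro x y
    rw [hg₂, hg₂, ← mul_sub, abs_mul, abs_of_pos (by positivity)]
    have e1 := abs_le.1 (hh.lipschitz (x + 2 * δ) (y + 2 * δ))
    have e2 := abs_le.1 (hh.lipschitz (x - 2 * δ) (y - 2 * δ))
    have e3 := abs_le.1 (hh.lipschitz x y)
    rw [add_sub_add_right_eq_sub] at e1
    rw [sub_sub_sub_cancel_right] at e2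
    have : |h (x + 2 * δ) + h (x - 2 * δ) - 2 * h x - (h (y + 2 * δ) + h (y - 2 * δ) - 2 * h y)|
        ≤ 4 * (L * |x - y|) := by
      rw [abs_le]
      constructor <;> linarith [e1.1, e1.2, e2.1, e2.2, e3.1, e3.2]
    calc _ ≤ D * D * (4 * (L * |x - y|)) := by gcongr
      _ = _ := by ring
  refine ⟨boxAverage δ A, g₁, g₂, 4 * D * D * L, max (D * (L * (2 * δ))) (D * D * (4 * L * δ)),
    ⟨?_, ?_, ?_, abs_taylor_two_le hd hd₁ hlip₂⟩, boxAverage_lipschitz hδ hA, ?_, ?_, ?_, ?_, ?_⟩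
  · exact boxAverage_neg (boxAverage_neg hh.odd)
  · intro z
    rw [hg₂, hg₂, hh.odd, show -z + 2 * δ = -(z - 2 * δ) by ring,
      show -z - 2 * δ = -(z + 2 * δ) by ring, hh.odd, hh.odd]
    ring
  · intro z hz
    rw [hg₂]
    have := hh.add_sub_le_two_mul hz (2 * δ)
    exact mul_nonpos_of_nonneg_of_nonpos (by positivity) (by linarith)
  · intro z
    have e1 := abs_boxAverage_sub_self_le hδ hL hA z
    have e2 := abs_boxAverage_sub_self_le hδ hL hh.lipschitz z
    have := abs_sub_le (boxAverage δ A z) (A z) (h z)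
    linarith
  · fun_prop
  · fun_prop
  · intro z
    refine le_trans ?_ (le_max_left _ _)
    simp only [g₁]
    rw [abs_mul, abs_of_pos hD0]
    have := hA (z + δ) (z - δ)
    rw [show z + δ - (z - δ) = 2 * δ by ring, abs_of_pos (by positivity : 0 < 2 * δ)] at this
    gcongr
  · intro z
    refine le_trans ?_ (le_max_right _ _)
    rw [hg₂, abs_mul, abs_of_pos (by positivity)]
    have e1 := abs_le.1 (hh.lipschitz (z + 2 * δ) z)
    have e2 := abs_le.1 (hh.lipschitz (z - 2 * δ) z)
    rw [add_sub_cancel_left, abs_of_pos (by positivity : 0 < 2 * δ)] at e1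
    rw [show z - 2 * δ - z = -(2 * δ) by ring, abs_neg,
      abs_of_pos (by positivity : 0 < 2 * δ)] at e2
    gcongr
    rw [abs_le]
    constructor <;> linarith [e1.1, e1.2, e2.1, e2.2]

/-! ### The heat semigroup -/

/-- The heat semigroup: convolution with the centred normal law of variance `τ`. -/
noncomputable def heat (τ : ℝ≥0) (f : ℝ → ℝ) (z : ℝ) : ℝ :=
  ∫ y, f (z + y) ∂(gaussianReal 0 τ)

section Heat

variable {f : ℝ → ℝ} {L : ℝ}

theorem integrable_gaussianReal_of_lipschitz (hf : ∀ x y, |f x - f y| ≤ L * |x - y|) (τ : ℝ≥0)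
    (z : ℝ) : Integrable (fun y => f (z + y)) (gaussianReal 0 τ) := by
  have hid : Integrable (fun y : ℝ => y) (gaussianReal 0 τ) :=
    (memLp_id_gaussianReal (μ := 0) (v := τ) 1).integrable le_rfl
  have hc := continuous_of_abs_sub_le hf
  refine ((integrable_const |f z|).add (hid.abs.const_mul L)).mono' ?_ ?_
  · exact (by fun_prop : Continuous fun y => f (z + y)).aestronglyMeasurable
  · filter_upwards with y
    have := hf (z + y) z
    rw [add_sub_cancel_left] at this
    have h2 := abs_sub_abs_le_abs_sub (f (z + y)) (f z)
    simp only [Real.norm_eq_abs, Pi.add_apply]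
    linarith

theorem integrable_gaussianReal_of_bounded (hf : Continuous f) {M : ℝ} (hM : ∀ z, |f z| ≤ M)
    (τ : ℝ≥0) (z : ℝ) : Integrable (fun y => f (z + y)) (gaussianReal 0 τ) :=
  Integrable.of_bound (by fun_prop : Continuous fun y => f (z + y)).aestronglyMeasurable M
    (Eventually.of_forall fun y => hM _)

theorem heat_zero (f : ℝ → ℝ) : heat 0 f = f := by
  funext z
  simp [heat, gaussianReal_zero_var]

theorem heat_neg (hf : ∀ z, f (-z) = -f z) (τ : ℝ≥0) (z : ℝ) :
    heat τ f (-z) = -heat τ f z := by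
  unfold heat
  have h1 : (gaussianReal 0 τ).map (fun x => -x) = gaussianReal 0 τ := by
    rw [gaussianReal_map_neg, neg_zero]
  calc ∫ y, f (-z + y) ∂(gaussianReal 0 τ)
      = ∫ y, f (-z + y) ∂((gaussianReal 0 τ).map (fun x => -x)) := by rw [h1]
    _ = ∫ y, f (-z + -y) ∂(gaussianReal 0 τ) :=
        (MeasurableEquiv.neg ℝ).measurableEmbedding.integral_map _
    _ = -∫ y, f (z + y) ∂(gaussianReal 0 τ) := by
        rw [← integral_neg]
        congr with y
        rw [← hf, neg_add]

theorem abs_heat_sub_le {g : ℝ → ℝ} {τ : ℝ≥0} {z w C : ℝ}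
    (hf : Integrable (fun y => f (z + y)) (gaussianReal 0 τ))
    (hg : Integrable (fun y => g (w + y)) (gaussianReal 0 τ))
    (h : ∀ y, |f (z + y) - g (w + y)| ≤ C) : |heat τ f z - heat τ g w| ≤ C := by
  unfold heat
  rw [← integral_sub hf hg]
  simpa using norm_integral_le_of_norm_le_const (μ := gaussianReal 0 τ)
    (f := fun y => f (z + y) - g (w + y)) (Eventually.of_forall h)

theorem heat_lipschitz (hf : ∀ x y, |f x - f y| ≤ L * |x - y|) (τ : ℝ≥0) (x y : ℝ) :
    |heat τ f x - heat τ f y| ≤ L * |x - y| := by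
  refine abs_heat_sub_le (integrable_gaussianReal_of_lipschitz hf τ x)
    (integrable_gaussianReal_of_lipschitz hf τ y) fun u => ?_
  simpa using hf (x + u) (y + u)

theorem heat_heat (hf : ∀ x y, |f x - f y| ≤ L * |x - y|) (s t : ℝ≥0) (z : ℝ) :
    heat s (heat t f) z = heat (t + s) f z := by
  have h1 : gaussianReal 0 s ∗ gaussianReal 0 t = gaussianReal 0 (t + s) := by
    rw [gaussianReal_conv_gaussianReal, add_zero, add_comm]
  have hc := continuous_of_abs_sub_le hf
  have hi := integrable_gaussianReal_of_lipschitz hf (t + s) z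
  unfold heat
  rw [← h1] at hi ⊢
  rw [integral_conv hi]
  simp only [add_assoc]

theorem gaussianPDFReal_add_le_sub {τ : ℝ≥0} {z u : ℝ} (h : 0 ≤ z * u) :
    gaussianPDFReal 0 τ (u + z) ≤ gaussianPDFReal 0 τ (u - z) := by
  unfold gaussianPDFReal
  gcongr ?_ * Real.exp (?_ / _)
  nlinarith

/-- The heat semigroup preserves odd functions that are nonpositive on `[0, ∞)`: by reflection,
the point `z ≥ 0` puts more weight on `u ≥ 0` than on `-u`. -/
theorem heat_nonpos (hf : Continuous f) {M : ℝ} (hM : ∀ z, |f z| ≤ M)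
    (hodd : ∀ z, f (-z) = -f z) (hneg : ∀ z, 0 ≤ z → f z ≤ 0) (τ : ℝ≥0) {z : ℝ} (hz : 0 ≤ z) :
    heat τ f z ≤ 0 := by
  rcases eq_or_ne τ 0 with rfl | hτ
  · rw [heat_zero]
    exact hneg z hz
  set p := gaussianPDFReal 0 τ with hp
  have hpi : Integrable p := integrable_gaussianPDFReal 0 τ
  have e1 : heat τ f z = ∫ u, p (u - z) * f u := by
    unfold heat
    rw [integral_gaussianReal_eq_integral_smul hτ, ← integral_sub_right_eq_self _ z]
    simp [hp]
  have e2 : heat τ f z = -∫ u, p (u + z) * f u := by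
    rw [e1, ← integral_neg_eq_self, ← integral_neg]
    congr with u
    have : p (-u - z) = p (u + z) := by
      simp only [hp, gaussianPDFReal]
      ring_nf
    rw [hodd, this]
    ring
  have i1 : Integrable fun u => p (u - z) * f u :=
    (hpi.comp_sub_right z).mul_bdd hf.aestronglyMeasurable (Eventually.of_forall hM)
  have i2 : Integrable fun u => p (u + z) * f u :=
    (hpi.comp_add_right z).mul_bdd hf.aestronglyMeasurable (Eventually.of_forall hM)
  have e3 : 2 * heat τ f z = ∫ u, (p (u - z) * f u - p (u + z) * f u) := by
    rw [integral_sub i1 i2, ← e1, two_mul]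
    nth_rewrite 2 [e2]
    ring
  have e4 : ∫ u, (p (u - z) * f u - p (u + z) * f u) ≤ 0 := by
    refine integral_nonpos fun u => ?_
    simp only [Pi.zero_apply, ← sub_mul]
    rcases le_total 0 u with hu | hu
    · exact mul_nonpos_of_nonneg_of_nonpos
        (sub_nonneg.2 (gaussianPDFReal_add_le_sub (mul_nonneg hz hu))) (hneg u hu)
    · have h1 : p (u - z) ≤ p (u + z) := by
        have := gaussianPDFReal_add_le_sub (τ := τ) (z := -z) (u := u)
          (mul_nonneg_of_nonpos_of_nonpos (by linarith) hu)
        rwa [sub_neg_eq_add, ← sub_eq_add_neg] at this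
      have h2 : 0 ≤ f u := by
        have := hneg (-u) (by linarith)
        rw [hodd] at this
        linarith
      exact mul_nonpos_of_nonpos_of_nonneg (sub_nonpos.2 h1) h2
  linarith

theorem OddJet.heat {f₁ f₂ : ℝ → ℝ} {K M : ℝ} (hj : OddJet f f₁ f₂ K)
    (hf : ∀ x y, |f x - f y| ≤ L * |x - y|) (hf₁ : Continuous f₁) (hf₂ : Continuous f₂)
    (hM₁ : ∀ z, |f₁ z| ≤ M) (hM₂ : ∀ z, |f₂ z| ≤ M) (τ : ℝ≥0) :
    OddJet (heat τ f) (heat τ f₁) (heat τ f₂) K where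
  odd := heat_neg hj.odd τ
  odd_second := heat_neg hj.odd_second τ
  second_nonpos z hz := heat_nonpos hf₂ hM₂ hj.odd_second hj.second_nonpos τ hz
  taylor z y := by
    have i0 := integrable_gaussianReal_of_lipschitz hf τ
    have i1 := integrable_gaussianReal_of_bounded hf₁ hM₁ τ z
    have i2 := integrable_gaussianReal_of_bounded hf₂ hM₂ τ z
    have j1 : Integrable (fun u => f (z + y + u) - f (z + u)) (gaussianReal 0 τ) :=
      (i0 (z + y)).sub (i0 z)
    have j2 : Integrable (fun u => f (z + y + u) - f (z + u) - f₁ (z + u) * y)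
      (gaussianReal 0 τ) := j1.sub (i1.mul_const y)
    unfold _root_.heat
    rw [← integral_sub (i0 _) (i0 _), ← integral_mul_const, ← integral_sub j1 (i1.mul_const _),
      ← integral_div, ← integral_mul_const, ← integral_sub j2 ((i2.div_const _).mul_const _)]
    have := norm_integral_le_of_norm_le_const (μ := gaussianReal 0 τ) (C := K * |y| ^ 3)
      (f := fun u => f (z + y + u) - f (z + u) - f₁ (z + u) * y - f₂ (z + u) / 2 * y ^ 2)
      (Eventually.of_forall fun u => by
        have := hj.taylor (z + u) y
        rwa [show z + u + y = z + y + u by ring] at this)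
    simpa using this

/-- The third absolute moment of the standard normal law. -/
noncomputable def gaussianThirdMoment : ℝ := ∫ y, |y| ^ 3 ∂(gaussianReal 0 1)

theorem integrable_abs_pow_gaussianReal (τ : ℝ≥0) (k : ℕ) :
    Integrable (fun y : ℝ => |y| ^ k) (gaussianReal 0 τ) := by
  have := (memLp_id_gaussianReal (μ := 0) (v := τ) k).integrable_norm_pow'
  simpa using this

theorem integral_abs_pow_three_gaussianReal (τ : ℝ≥0) :
    ∫ y, |y| ^ 3 ∂(gaussianReal 0 τ) = gaussianThirdMoment * √τ ^ 3 := by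
  have h1 : (gaussianReal 0 1).map (√(τ : ℝ) * ·) = gaussianReal 0 τ := by
    rw [gaussianReal_map_const_mul]
    congr 1
    · simp
    · ext
      simp
  rw [← h1, integral_map (by fun_prop) (by fun_prop), gaussianThirdMoment, ← integral_mul_const]
  congr with y
  rw [abs_mul, mul_pow, abs_of_nonneg (Real.sqrt_nonneg _), mul_comm]

theorem abs_heat_sub_le_of_taylor {f₁ f₂ : ℝ → ℝ} {K : ℝ} (hj : OddJet f f₁ f₂ K)
    (hf : ∀ x y, |f x - f y| ≤ L * |x - y|) (τ : ℝ≥0) (z : ℝ) :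
    |heat τ f z - f z - f₂ z / 2 * τ| ≤ K * gaussianThirdMoment * √τ ^ 3 := by
  have i0 := integrable_gaussianReal_of_lipschitz hf τ z
  have i1 : Integrable (fun y : ℝ => y) (gaussianReal 0 τ) :=
    (memLp_id_gaussianReal (μ := 0) (v := τ) 1).integrable le_rfl
  have i2 : Integrable (fun y : ℝ => y ^ 2) (gaussianReal 0 τ) := by
    simpa using integrable_abs_pow_gaussianReal τ 2
  have m1 : ∫ y, y ∂(gaussianReal 0 τ) = 0 := integral_id_gaussianReal
  have m2 : ∫ y, y ^ 2 ∂(gaussianReal 0 τ) = τ := by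
    have := variance_id_gaussianReal (μ := 0) (v := τ)
    rw [variance_eq_sub (memLp_id_gaussianReal 2)] at this
    simpa [m1] using this
  have h1 : heat τ f z - f z - f₂ z / 2 * τ =
      ∫ y, (f (z + y) - f z - f₁ z * y - f₂ z / 2 * y ^ 2) ∂(gaussianReal 0 τ) := by
    have j1 : Integrable (fun y => f (z + y) - f z) (gaussianReal 0 τ) :=
      i0.sub (integrable_const _)
    have j2 : Integrable (fun y => f (z + y) - f z - f₁ z * y) (gaussianReal 0 τ) :=
      j1.sub (i1.const_mul _)
    rw [integral_sub j2 (i2.const_mul _), integral_sub j1 (i1.const_mul _),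
      integral_sub i0 (integrable_const _), integral_const_mul, integral_const_mul, m1, m2]
    simp [heat]
  rw [h1, mul_assoc, ← integral_abs_pow_three_gaussianReal, ← integral_const_mul]
  exact norm_integral_le_of_norm_le ((integrable_abs_pow_gaussianReal τ 3).const_mul K)
    (f := fun y => f (z + y) - f z - f₁ z * y - f₂ z / 2 * y ^ 2)
    (Eventually.of_forall fun y => hj.taylor z y)

end Heat

/-! ### Gluing at the threshold -/

/-- The function that equals `f` in the normalized coordinate `(x - c) / σlo` above the threshold
`c`, and `σhi / σlo` times `f` in the coordinate `(x - c) / σhi` below it. The factor makes the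
slopes on both sides of `c` agree. -/
noncomputable def glue (σlo σhi c : ℝ) (f : ℝ → ℝ) (x : ℝ) : ℝ :=
  if c ≤ x then f ((x - c) / σlo) else σhi / σlo * f ((x - c) / σhi)

section Glue

variable {σlo σhi c K L : ℝ} {f f₁ f₂ : ℝ → ℝ}

theorem abs_glue_sub_le (hσlo : 0 < σlo) (hσ : σlo < σhi) {g : ℝ → ℝ} {C : ℝ}
    (h : ∀ z, |f z - g z| ≤ C) (x : ℝ) :
    |glue σlo σhi c f x - glue σlo σhi c g x| ≤ σhi / σlo * C := by
  have hC : 0 ≤ C := (abs_nonneg _).trans (h 0)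
  have hθ : 1 ≤ σhi / σlo := (one_le_div hσlo).2 hσ.le
  unfold glue
  split_ifs
  · exact (h _).trans (le_mul_of_one_le_left hC hθ)
  · rw [← mul_sub, abs_mul, abs_of_pos (by positivity)]
    exact mul_le_mul_of_nonneg_left (h _) (by positivity)

/-- The second-order coefficient of `glue σlo σhi c f`, when `f₂` is that of `f`. -/
noncomputable def glueSecond (σlo σhi c : ℝ) (f₂ : ℝ → ℝ) (x : ℝ) : ℝ :=
  if c ≤ x then f₂ ((x - c) / σlo) / σlo ^ 2 else σhi / σlo * (f₂ ((x - c) / σhi) / σhi ^ 2)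

/-- Gluing preserves second-order expansions with cubic error, across the threshold as well: by
oddness `f` has neither a constant nor a second-order term at the origin, and the linear terms of
the two branches coincide. -/
theorem exists_abs_glue_taylor_le (hσlo : 0 < σlo) (hσ : σlo < σhi) (hj : OddJet f f₁ f₂ K)
    (x : ℝ) : ∃ a, ∀ y, |glue σlo σhi c f (x + y) - glue σlo σhi c f x - a * y
      - glueSecond σlo σhi c f₂ x / 2 * y ^ 2| ≤ 3 * K / σlo ^ 3 * |y| ^ 3 := by
  have hK := hj.nonneg
  have hσhi : 0 < σhi := hσlo.trans hσ
  have scale : ∀ σ, 0 < σ → ∀ w y, |f ((w + y) / σ) - f (w / σ) - f₁ (w / σ) / σ * y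
      - f₂ (w / σ) / σ ^ 2 / 2 * y ^ 2| ≤ K / σ ^ 3 * |y| ^ 3 := by
    intro σ hσ w y
    have := hj.taylor (w / σ) (y / σ)
    rw [abs_div, abs_of_pos hσ, div_pow, ← add_div] at this
    convert this using 1
    · congr 1
      field_simp
    · field_simp
  have tlo := scale σlo hσlo
  have thi : ∀ w y, |σhi / σlo * f ((w + y) / σhi) - σhi / σlo * f (w / σhi)
      - f₁ (w / σhi) / σlo * y - σhi / σlo * (f₂ (w / σhi) / σhi ^ 2) / 2 * y ^ 2|
      ≤ K / σlo ^ 3 * |y| ^ 3 := by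
    intro w y
    have h1 := mul_le_mul_of_nonneg_left (scale σhi hσhi w y) (show 0 ≤ σhi / σlo by positivity)
    rw [← abs_of_pos (show 0 < σhi / σlo by positivity), ← abs_mul,
      abs_of_pos (show 0 < σhi / σlo by positivity)] at h1
    have h2 : σhi / σlo * (K / σhi ^ 3 * |y| ^ 3) ≤ K / σlo ^ 3 * |y| ^ 3 := by
      rw [← mul_assoc]
      gcongr ?_ * _
      rw [show σhi / σlo * (K / σhi ^ 3) = K / (σlo * σhi ^ 2) by field_simp]
      have : σlo ^ 3 ≤ σlo * σhi ^ 2 := by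
        rw [show σlo ^ 3 = σlo * σlo ^ 2 by ring]
        gcongr
      gcongr
    refine le_trans (le_of_eq ?_) (h1.trans h2)
    congr 1
    field_simp
  have cross : ∀ w, |f (w / σlo) - σhi / σlo * f (w / σhi)| ≤ 2 * K / σlo ^ 3 * |w| ^ 3 := by
    intro w
    have h1 := abs_le.1 (tlo 0 w)
    have h2 := abs_le.1 (thi 0 w)
    simp only [zero_div, zero_add, eq_zero_of_odd hj.odd, eq_zero_of_odd hj.odd_second, mul_zero,
      zero_mul, sub_zero] at h1 h2
    rw [abs_le, mul_div_assoc, mul_assoc]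
    constructor <;> linarith [h1.1, h1.2, h2.1, h2.2]
  have e : 3 * K / σlo ^ 3 = K / σlo ^ 3 + 2 * K / σlo ^ 3 := by ring
  have hpos : ∀ y, 0 ≤ 2 * K / σlo ^ 3 * |y| ^ 3 := fun y => by positivity
  by_cases hx : c ≤ x
  · refine ⟨f₁ ((x - c) / σlo) / σlo, fun y => ?_⟩
    have h1 := tlo (x - c) y
    rw [show x - c + y = x + y - c by ring] at h1
    simp only [glue, glueSecond, if_pos hx, e, add_mul]
    by_cases hy : c ≤ x + y
    · rw [if_pos hy]
      linarith [hpos y]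
    · rw [if_neg hy]
      have h2 := cross (x + y - c)
      have h3 : |x + y - c| ≤ |y| := by
        rw [abs_of_neg (by linarith), abs_of_neg (by linarith)]
        linarith
      have h4 : 2 * K / σlo ^ 3 * |x + y - c| ^ 3 ≤ 2 * K / σlo ^ 3 * |y| ^ 3 := by gcongr
      rw [abs_le] at h1 h2 ⊢
      constructor <;> linarith [h1.1, h1.2, h2.1, h2.2]
  · refine ⟨f₁ ((x - c) / σhi) / σlo, fun y => ?_⟩
    have h1 := thi (x - c) y
    rw [show x - c + y = x + y - c by ring] at h1
    simp only [glue, glueSecond, if_neg hx, e, add_mul]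
    by_cases hy : c ≤ x + y
    · rw [if_pos hy]
      have h2 := cross (x + y - c)
      have h3 : |x + y - c| ≤ |y| := by
        rw [abs_of_nonneg (by linarith), abs_of_pos (by linarith)]
        linarith
      have h4 : 2 * K / σlo ^ 3 * |x + y - c| ^ 3 ≤ 2 * K / σlo ^ 3 * |y| ^ 3 := by gcongr
      rw [abs_le] at h1 h2 ⊢
      constructor <;> linarith [h1.1, h1.2, h2.1, h2.2]
    · rw [if_neg hy]
      linarith [hpos y]

/-- The optimal variance: low above the threshold, where the value function is concave, and high
below it, where the value function is convex. -/
noncomputable def optimalVariance (σlo σhi c x : ℝ) : ℝ :=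
  if c ≤ x then σlo ^ 2 else σhi ^ 2

theorem glueSecond_mul_le (hσlo : 0 < σlo) (hσ : σlo < σhi) (hj : OddJet f f₁ f₂ K)
    {v : ℝ} (hlo : σlo ^ 2 ≤ v) (hhi : v ≤ σhi ^ 2) (x : ℝ) :
    glueSecond σlo σhi c f₂ x * v ≤ glueSecond σlo σhi c f₂ x * optimalVariance σlo σhi c x := by
  have hσhi : 0 < σhi := hσlo.trans hσ
  unfold glueSecond optimalVariance
  split_ifs with hx
  · refine mul_le_mul_of_nonpos_left hlo (div_nonpos_of_nonpos_of_nonneg ?_ (by positivity))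
    exact hj.second_nonpos _ (div_nonneg (by linarith) hσlo.le)
  · refine mul_le_mul_of_nonneg_left hhi ?_
    have := hj.second_nonpos (-((x - c) / σhi)) (by
      rw [← neg_div]
      exact div_nonneg (by linarith) hσhi.le)
    rw [hj.odd_second] at this
    have h2 : 0 ≤ f₂ ((x - c) / σhi) := by linarith
    positivity

/-- The glued heat flow solves the heat equation with diffusion coefficient `optimalVariance`, in
the discrete form needed here. -/
theorem abs_glue_heat_sub_le (hσlo : 0 < σlo) (hσ : σlo < σhi) (hj : OddJet f f₁ f₂ K)
    (hf : ∀ x y, |f x - f y| ≤ L * |x - y|) (τ : ℝ≥0) (x : ℝ) :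
    |glue σlo σhi c (heat τ f) x - glue σlo σhi c f x
      - glueSecond σlo σhi c f₂ x * optimalVariance σlo σhi c x / 2 * τ|
      ≤ σhi / σlo * (K * gaussianThirdMoment * √τ ^ 3) := by
  have hσhi : 0 < σhi := hσlo.trans hσ
  have hθ : 1 ≤ σhi / σlo := (one_le_div hσlo).2 hσ.le
  have h := abs_heat_sub_le_of_taylor hj hf τ
  unfold glue glueSecond optimalVariance
  split_ifs
  · rw [div_mul_cancel₀ _ (by positivity)]
    exact (h _).trans (le_mul_of_one_le_left ((abs_nonneg _).trans (h 0)) hθ)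
  · have := mul_le_mul_of_nonneg_left (h ((x - c) / σhi)) (show 0 ≤ σhi / σlo by positivity)
    rw [← abs_of_pos (show 0 < σhi / σlo by positivity), ← abs_mul,
      abs_of_pos (show 0 < σhi / σlo by positivity)] at this
    refine le_trans (le_of_eq ?_) this
    congr 1
    field_simp

/-- The error constant of one stage, for outcomes bounded by `R`. -/
noncomputable def stageError (σlo σhi K R : ℝ) : ℝ :=
  3 * K / σlo ^ 3 * R ^ 3 + σhi / σlo * (K * gaussianThirdMoment)

theorem abs_integral_glue_sub_le (hσlo : 0 < σlo) (hσ : σlo < σhi) (hj : OddJet f f₁ f₂ K)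
    (hf : ∀ x y, |f x - f y| ≤ L * |x - y|) {Ω : Finset ℝ} (μ : Measure Ω)
    [IsProbabilityMeasure μ] (hμ : ∫ x, (x : ℝ) ∂μ = 0) {R : ℝ} (hR : ∀ x ∈ Ω, |x| ≤ R)
    (τ : ℝ≥0) (x : ℝ) :
    |∫ y, glue σlo σhi c f (x + √τ * (y : ℝ)) ∂μ - glue σlo σhi c (heat τ f) x
      - glueSecond σlo σhi c f₂ x
        * (∫ y, (y : ℝ) ^ 2 ∂μ - optimalVariance σlo σhi c x) / 2 * τ|
      ≤ stageError σlo σhi K R * √τ ^ 3 := by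
  have hK := hj.nonneg
  obtain ⟨a, ha⟩ := exists_abs_glue_taylor_le (c := c) hσlo hσ hj x
  set G := glue σlo σhi c f
  set b := glueSecond σlo σhi c f₂ x
  have i (F : Ω → ℝ) : Integrable F μ := Integrable.of_finite
  have h1 : |∫ y : Ω, (G (x + √τ * (y : ℝ)) - G x - a * (√τ * (y : ℝ))
      - b / 2 * (√τ * (y : ℝ)) ^ 2) ∂μ| ≤ 3 * K / σlo ^ 3 * (√τ * R) ^ 3 := by
    have := norm_integral_le_of_norm_le_const (μ := μ) (C := 3 * K / σlo ^ 3 * (√τ * R) ^ 3)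
      (f := fun y : Ω => G (x + √τ * (y : ℝ)) - G x - a * (√τ * (y : ℝ))
        - b / 2 * (√τ * (y : ℝ)) ^ 2) (Eventually.of_forall fun y => by
          refine (ha _).trans ?_
          rw [abs_mul, abs_of_nonneg (Real.sqrt_nonneg _)]
          have := hR y y.2
          gcongr)
    simpa using this
  have h2 : ∫ y : Ω, (G (x + √τ * (y : ℝ)) - G x - a * (√τ * (y : ℝ))
      - b / 2 * (√τ * (y : ℝ)) ^ 2) ∂μ
      = ∫ y : Ω, G (x + √τ * (y : ℝ)) ∂μ - G x - b / 2 * τ * ∫ y : Ω, (y : ℝ) ^ 2 ∂μ := by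
    rw [integral_sub (i _) (i _), integral_sub (i _) (i _), integral_sub (i _) (i _)]
    simp only [mul_pow, integral_const_mul, hμ, Real.sq_sqrt τ.coe_nonneg, integral_const,
      probReal_univ, one_smul]
    ring
  rw [h2] at h1
  have h3 := abs_glue_heat_sub_le (c := c) hσlo hσ hj hf τ x
  rw [stageError]
  rw [abs_le] at h1 h3 ⊢
  constructor <;> linarith [h1.1, h1.2, h3.1, h3.2]

end Glue

/-! ### The law of the outcomes -/

section Outcomes

variable {A : Type*} {Ω : Finset ℝ} (B : Beliefs A Ω) (s : Strategy A Ω)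

instance (n : ℕ) (ω : Fin n → Ω) : IsProbabilityMeasure (stageLaw B s n ω) := by
  unfold stageLaw
  infer_instance

instance : IsProbabilityMeasure (outcomeLaw B s) := by
  unfold outcomeLaw
  infer_instance

/-- The first `n` outcomes of an infinite outcome sequence. -/
def outcomeHistory (n : ℕ) (ω : ℕ → Ω) : Fin n → Ω := fun i => ω i

theorem measurable_outcomeHistory (n : ℕ) : Measurable (outcomeHistory (Ω := Ω) n) :=
  measurable_pi_lambda _ fun _ => measurable_pi_apply _

theorem integrable_outcomeHistory (n : ℕ) (F : (Fin n → Ω) → ℝ) :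
    Integrable (fun ω => F (outcomeHistory n ω)) (outcomeLaw B s) := by
  obtain ⟨M, hM⟩ := (Set.finite_range fun x => ‖F x‖).bddAbove
  exact Integrable.of_bound
    ((measurable_of_finite F).comp (measurable_outcomeHistory n)).aestronglyMeasurable M
    (Eventually.of_forall fun ω => hM ⟨outcomeHistory n ω, rfl⟩)

theorem map_eval_zero_outcomeLaw :
    (outcomeLaw B s).map (fun ω => ω 0) = stageLaw B s 0 Fin.elim0 := by
  have h1 : (fun ω : ℕ → Ω => ω 0) = (fun x => x ⟨0, by simp⟩) ∘
      Preorder.frestrictLe (π := fun _ => Ω) 0 := rfl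
  rw [h1, ← Measure.map_map (by fun_prop) (by fun_prop), outcomeLaw, Kernel.trajMeasure,
    Measure.map_comp _ _ (by fun_prop), Kernel.traj_map_frestrictLe, Kernel.partialTraj_self,
    Measure.id_comp, Measure.map_map (by fun_prop) (by fun_prop)]
  convert Measure.map_id
  funext x
  exact (MeasurableEquiv.piUnique fun _ : Finset.Iic 0 => (Ω : Type)).apply_symm_apply x

/-- The defining property of the law of the outcomes: given the first `n` outcomes, the next one
has the law `stageLaw B s n`. -/
theorem integral_outcomeLaw_succ (n : ℕ) (F : (Fin n → Ω) → Ω → ℝ) :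
    ∫ ω, F (outcomeHistory n ω) (ω n) ∂(outcomeLaw B s) =
      ∫ ω, ∫ x, F (outcomeHistory n ω) x ∂(stageLaw B s n (outcomeHistory n ω))
        ∂(outcomeLaw B s) := by
  cases n with
  | zero =>
    have h0 : ∀ ω : ℕ → Ω, outcomeHistory 0 ω = Fin.elim0 := fun ω => Subsingleton.elim _ _
    simp only [h0, integral_const, probReal_univ, one_smul]
    rw [← map_eval_zero_outcomeLaw, integral_map (measurable_pi_apply 0).aemeasurable
      (measurable_of_finite _).aestronglyMeasurable]
  | succ a =>
    let e : ((_ : Finset.Iic a) → Ω) → Fin (a + 1) → Ω := fun x k =>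
      x ⟨k, Finset.mem_Iic.2 (Nat.lt_succ_iff.1 k.isLt)⟩
    have he : ∀ ω : ℕ → Ω, e (Preorder.frestrictLe a ω) = outcomeHistory (a + 1) ω := fun ω => rfl
    have hk : ∀ x, stageKernel B s a x = stageLaw B s (a + 1) (e x) := fun x => rfl
    have key := Kernel.map_frestrictLe_trajMeasure_compProd_eq_map_trajMeasure
      (X := fun _ => Ω) (μ₀ := stageLaw B s 0 Fin.elim0) (κ := stageKernel B s) (a := a)
    change (outcomeLaw B s).map _ ⊗ₘ _ = (outcomeLaw B s).map _ at key
    have hF : Measurable fun p : ((_ : Finset.Iic a) → Ω) × Ω => F (e p.1) p.2 :=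
      measurable_of_finite _
    calc ∫ ω, F (outcomeHistory (a + 1) ω) (ω (a + 1)) ∂(outcomeLaw B s)
        = ∫ p, F (e p.1) p.2 ∂((outcomeLaw B s).map
            fun x => (Preorder.frestrictLe (π := fun _ => Ω) a x, x (a + 1))) := by
          rw [integral_map (by fun_prop) hF.aestronglyMeasurable]
          rfl
      _ = ∫ x, ∫ y, F (e x) y ∂(stageKernel B s a x)
            ∂((outcomeLaw B s).map (Preorder.frestrictLe (π := fun _ => Ω) a)) := by
          rw [← key, Measure.integral_compProd Integrable.of_finite]
      _ = _ := by
          rw [integral_map (by fun_prop) (measurable_of_finite _).aestronglyMeasurable]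
          rfl

end Outcomes

/-! ### Convergence of the values -/

section Value

variable {A : Type*} {Ω : Finset ℝ} {B : Beliefs A Ω} {σlo σhi c K L R : ℝ}
  {f f₁ f₂ : ℝ → ℝ}

theorem Beliefs.Admissible.nonempty (hB : B.Admissible σlo σhi) : Nonempty A := by
  obtain ⟨⟨b, -⟩, -⟩ := hB.max_variance 0 Fin.elim0 Fin.elim0
  exact ⟨b⟩

theorem expectedUtility_eq (φ : ℝ → ℝ) (n : ℕ) (s : Strategy A Ω) :
    expectedUtility B φ n s =
      ∫ ω, φ ((∑ i, (outcomeHistory n ω i : ℝ)) / √n) ∂(outcomeLaw B s) := by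
  simp only [expectedUtility, Finset.sum_range]
  rfl

theorem bddAbove_range_expectedUtility (B : Beliefs A Ω) (φ : ℝ → ℝ) (n : ℕ) :
    BddAbove (Set.range (expectedUtility B φ n)) := by
  obtain ⟨M, hM⟩ := (Set.finite_range fun x : Fin n → Ω => φ ((∑ i, (x i : ℝ)) / √n)).bddAbove
  refine ⟨M, ?_⟩
  rintro _ ⟨s, rfl⟩
  rw [expectedUtility_eq]
  calc _ ≤ ∫ _, M ∂(outcomeLaw B s) :=
        integral_mono (integrable_outcomeHistory B s n fun x => φ ((∑ i, (x i : ℝ)) / √n))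
          (integrable_const M) fun ω => hM ⟨outcomeHistory n ω, rfl⟩
    _ = M := by simp

theorem isLUB_value (hB : B.Admissible σlo σhi) (φ : ℝ → ℝ) (n : ℕ) :
    IsLUB (Set.range (expectedUtility B φ n)) (value B φ n) := by
  have := hB.nonempty
  exact isLUB_ciSup (bddAbove_range_expectedUtility B φ n)

/-- The position after `j` stages of the outcome sequence `ω`, in steps of size `r`. -/
def position (r : ℝ) (j : ℕ) (ω : Fin j → Ω) : ℝ := r * ∑ i, (ω i : ℝ)

theorem position_outcomeHistory_succ (r : ℝ) (j : ℕ) (ω : ℕ → Ω) :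
    position r (j + 1) (outcomeHistory (j + 1) ω) =
      position r j (outcomeHistory j ω) + r * (ω j : ℝ) := by
  simp [position, outcomeHistory, Fin.sum_univ_castSucc, mul_add]

theorem integral_glue_position_succ (s : Strategy A Ω) (r : ℝ) (j : ℕ) (f : ℝ → ℝ) :
    ∫ ω, glue σlo σhi c f (position r (j + 1) (outcomeHistory (j + 1) ω)) ∂(outcomeLaw B s) =
      ∫ ω, ∫ x, glue σlo σhi c f (position r j (outcomeHistory j ω) + r * (x : ℝ))
        ∂(stageLaw B s j (outcomeHistory j ω)) ∂(outcomeLaw B s) := by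
  simp only [position_outcomeHistory_succ]
  exact integral_outcomeLaw_succ B s j
    fun h x => glue σlo σhi c f (position r j h + r * (x : ℝ))

/-- One stage of the dynamic programme, upper bound: no strategy gains more than the glued heat
flow up to the stage error. -/
theorem integral_glue_succ_le (hσlo : 0 < σlo) (hσ : σlo < σhi) (hB : B.Admissible σlo σhi)
    (hj : OddJet f f₁ f₂ K) (hf : ∀ x y, |f x - f y| ≤ L * |x - y|) (hR : ∀ x ∈ Ω, |x| ≤ R)
    (s : Strategy A Ω) (τ : ℝ≥0) (j : ℕ) :
    ∫ ω, glue σlo σhi c f (position √τ (j + 1) (outcomeHistory (j + 1) ω)) ∂(outcomeLaw B s) ≤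
      ∫ ω, glue σlo σhi c (heat τ f) (position √τ j (outcomeHistory j ω)) ∂(outcomeLaw B s)
        + stageError σlo σhi K R * √τ ^ 3 := by
  rw [integral_glue_position_succ]
  have i1 := integrable_outcomeHistory B s j fun h =>
    ∫ x, glue σlo σhi c f (position √τ j h + √τ * (x : ℝ)) ∂(stageLaw B s j h)
  have i2 := integrable_outcomeHistory B s j fun h =>
    glue σlo σhi c (heat τ f) (position √τ j h) + stageError σlo σhi K R * √τ ^ 3
  refine (integral_mono i1 i2 fun ω => ?_).trans (le_of_eq ?_)
  · set h := outcomeHistory j ω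
    have key := (abs_le.1 (abs_integral_glue_sub_le (c := c) hσlo hσ hj hf (stageLaw B s j h)
      (hB.mean_zero _ _ _ _) hR τ (position √τ j h))).2
    have hv := glueSecond_mul_le (c := c) hσlo hσ hj
      ((hB.min_variance j (armHistory s j h) h).2 ⟨s j (armHistory s j h) h, rfl⟩)
      ((hB.max_variance j (armHistory s j h) h).2 ⟨s j (armHistory s j h) h, rfl⟩)
      (position √τ j h)
    change _ * (∫ x, (x : ℝ) ^ 2 ∂(stageLaw B s j h)) ≤ _ at hv
    have : glueSecond σlo σhi c f₂ (position √τ j h) * (∫ x, (x : ℝ) ^ 2 ∂(stageLaw B s j h)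
        - optimalVariance σlo σhi c (position √τ j h)) / 2 * τ ≤ 0 := by
      rw [mul_sub]
      exact mul_nonpos_of_nonpos_of_nonneg (by linarith) τ.coe_nonneg
    simp only
    linarith
  · rw [integral_add (integrable_outcomeHistory B s j fun h =>
      glue σlo σhi c (heat τ f) (position √τ j h)) (integrable_const _)]
    simp

/-- One stage of the dynamic programme, lower bound: a strategy whose arms have the optimal
variance follows the glued heat flow up to the stage error. -/
theorem le_integral_glue_succ (hσlo : 0 < σlo) (hσ : σlo < σhi) (hB : B.Admissible σlo σhi)
    (hj : OddJet f f₁ f₂ K) (hf : ∀ x y, |f x - f y| ≤ L * |x - y|) (hR : ∀ x ∈ Ω, |x| ≤ R)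
    {s : Strategy A Ω} {τ : ℝ≥0} (hs : ∀ j h, ∫ x, (x : ℝ) ^ 2 ∂(stageLaw B s j h) =
      optimalVariance σlo σhi c (position √τ j h)) (j : ℕ) :
    ∫ ω, glue σlo σhi c (heat τ f) (position √τ j (outcomeHistory j ω)) ∂(outcomeLaw B s)
        - stageError σlo σhi K R * √τ ^ 3 ≤
      ∫ ω, glue σlo σhi c f (position √τ (j + 1) (outcomeHistory (j + 1) ω))
        ∂(outcomeLaw B s) := by
  rw [integral_glue_position_succ]
  have i1 := integrable_outcomeHistory B s j fun h =>
    ∫ x, glue σlo σhi c f (position √τ j h + √τ * (x : ℝ)) ∂(stageLaw B s j h)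
  have i2 := integrable_outcomeHistory B s j fun h =>
    glue σlo σhi c (heat τ f) (position √τ j h) - stageError σlo σhi K R * √τ ^ 3
  refine (le_of_eq ?_).trans (integral_mono i2 i1 fun ω => ?_)
  · rw [integral_sub (integrable_outcomeHistory B s j fun h =>
      glue σlo σhi c (heat τ f) (position √τ j h)) (integrable_const _)]
    simp
  · set h := outcomeHistory j ω
    have key := (abs_le.1 (abs_integral_glue_sub_le (c := c) hσlo hσ hj hf (stageLaw B s j h)
      (hB.mean_zero _ _ _ _) hR τ (position √τ j h))).1
    rw [hs, sub_self, mul_zero, zero_div, zero_mul] at key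
    simp only
    linarith

theorem exists_optimal_strategy (hB : B.Admissible σlo σhi) (c r : ℝ) :
    ∃ s : Strategy A Ω, ∀ j h, ∫ x, (x : ℝ) ^ 2 ∂(stageLaw B s j h) =
      optimalVariance σlo σhi c (position r j h) := by
  have : ∀ (j : ℕ) (a : Fin j → A) (h : Fin j → Ω), ∃ b : A,
      ∫ x, (x : ℝ) ^ 2 ∂(B j a h b : Measure Ω) =
        optimalVariance σlo σhi c (position r j h) := by
    intro j a h
    unfold optimalVariance
    split_ifs
    · exact (hB.min_variance j a h).1
    · exact (hB.max_variance j a h).1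
  choose s hs using this
  exact ⟨s, fun j h => hs j (armHistory s j h) h⟩

theorem sqrt_inv_natCast {n : ℕ} (hn : 0 < n) :
    (n : ℝ) * √((n : ℝ≥0)⁻¹ : ℝ≥0) ^ 3 = 1 / √n := by
  have hn' : (0 : ℝ) < n := Nat.cast_pos.2 hn
  rw [NNReal.coe_inv, NNReal.coe_natCast, Real.sqrt_inv]
  have h := Real.sq_sqrt hn'.le
  have h2 : 0 < √(n : ℝ) := Real.sqrt_pos.2 hn'
  nth_rewrite 1 [← h]
  field_simp

theorem position_sqrt_inv (n j : ℕ) (h : Fin j → Ω) :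
    position √((n : ℝ≥0)⁻¹ : ℝ≥0) j h = (∑ i, (h i : ℝ)) / √n := by
  rw [position, NNReal.coe_inv, NNReal.coe_natCast, Real.sqrt_inv, inv_mul_eq_div]

/-- Iterating the stages: the expected glued utility of any strategy over the horizon `n` is at
most the glued heat flow at time `1`, and the optimal strategies attain it, up to `O(n ^ (-1/2))`. -/
theorem expectedUtility_glue_bounds (hσlo : 0 < σlo) (hσ : σlo < σhi)
    (hB : B.Admissible σlo σhi) (hj : ∀ τ, ∃ f₁ f₂, OddJet (heat τ f) f₁ f₂ K)
    (hf : ∀ x y, |f x - f y| ≤ L * |x - y|) (hR : ∀ x ∈ Ω, |x| ≤ R) {n : ℕ} (hn : 0 < n) :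
    (∀ s, expectedUtility B (glue σlo σhi c f) n s ≤
      glue σlo σhi c (heat 1 f) 0 + stageError σlo σhi K R * (1 / √n)) ∧
    ∃ s, glue σlo σhi c (heat 1 f) 0 - stageError σlo σhi K R * (1 / √n) ≤
      expectedUtility B (glue σlo σhi c f) n s := by
  set τ : ℝ≥0 := (n : ℝ≥0)⁻¹ with hτ
  -- the expected value after `j` stages, with remaining time `(n - j) / n`
  let D (s : Strategy A Ω) (j : ℕ) : ℝ :=
    ∫ ω, glue σlo σhi c (heat ((n - j : ℕ) * τ) f) (position √τ j (outcomeHistory j ω))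
      ∂(outcomeLaw B s)
  have hD0 : ∀ s, D s 0 = glue σlo σhi c (heat 1 f) 0 := by
    intro s
    have h1 : ((n - 0 : ℕ) : ℝ≥0) * τ = 1 := by
      rw [Nat.sub_zero, hτ, mul_inv_cancel₀ (Nat.cast_ne_zero.2 hn.ne')]
    simp only [D, h1]
    simp [position]
  have hDn : ∀ s, D s n = expectedUtility B (glue σlo σhi c f) n s := by
    intro s
    simp only [D, Nat.sub_self, Nat.cast_zero, zero_mul, heat_zero, expectedUtility_eq, hτ,
      position_sqrt_inv]
  have hflow : ∀ j < n, heat τ (heat ((n - (j + 1) : ℕ) * τ) f) = heat ((n - j : ℕ) * τ) f := by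
    intro j hjn
    funext z
    rw [heat_heat hf]
    congr 1
    rw [show n - j = (n - (j + 1)) + 1 by omega]
    push_cast
    ring
  have hsum : stageError σlo σhi K R * (1 / √n) = n * (stageError σlo σhi K R * √τ ^ 3) := by
    rw [← sqrt_inv_natCast hn]
    ring
  rw [hsum]
  constructor
  · intro s
    have : ∀ j ≤ n, D s j ≤ D s 0 + j * (stageError σlo σhi K R * √τ ^ 3) := by
      intro j
      induction j with
      | zero => simp
      | succ j ih =>
        intro hjn
        obtain ⟨f₁, f₂, hj'⟩ := hj ((n - (j + 1) : ℕ) * τ)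
        have := integral_glue_succ_le (c := c) hσlo hσ hB hj' (heat_lipschitz hf _) hR s τ j
        rw [hflow j hjn] at this
        have h2 := ih (by omega)
        push_cast
        simp only [D] at h2 ⊢
        linarith
    have := this n le_rfl
    rwa [hD0, hDn] at this
  · obtain ⟨s, hs⟩ := exists_optimal_strategy hB c √τ
    refine ⟨s, ?_⟩
    have : ∀ j ≤ n, D s 0 - j * (stageError σlo σhi K R * √τ ^ 3) ≤ D s j := by
      intro j
      induction j with
      | zero => simp
      | succ j ih =>
        intro hjn
        obtain ⟨f₁, f₂, hj'⟩ := hj ((n - (j + 1) : ℕ) * τ)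
        have := le_integral_glue_succ (c := c) hσlo hσ hB hj' (heat_lipschitz hf _) hR hs j
        rw [hflow j hjn] at this
        have h2 := ih (by omega)
        push_cast
        simp only [D] at h2 ⊢
        linarith
    have := this n le_rfl
    rwa [hD0, hDn] at this

theorem abs_expectedUtility_sub_le {φ ψ : ℝ → ℝ} {C : ℝ} (h : ∀ x, |φ x - ψ x| ≤ C) (n : ℕ)
    (s : Strategy A Ω) : |expectedUtility B φ n s - expectedUtility B ψ n s| ≤ C := by
  rw [expectedUtility_eq, expectedUtility_eq, ← integral_sub
    (integrable_outcomeHistory B s n fun x => φ ((∑ i, (x i : ℝ)) / √n))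
    (integrable_outcomeHistory B s n fun x => ψ ((∑ i, (x i : ℝ)) / √n))]
  have := norm_integral_le_of_norm_le_const (μ := outcomeLaw B s) (C := C)
    (f := fun ω => φ ((∑ i, (outcomeHistory n ω i : ℝ)) / √n)
      - ψ ((∑ i, (outcomeHistory n ω i : ℝ)) / √n)) (Eventually.of_forall fun ω => h _)
  simpa using this

theorem tendsto_value_glue {h : ℝ → ℝ} (hσlo : 0 < σlo) (hσ : σlo < σhi)
    (hB : B.Admissible σlo σhi) (hh : OddConcave h L) (c : ℝ) :
    Tendsto (value B (glue σlo σhi c h)) atTop (𝓝 (glue σlo σhi c (heat 1 h) 0)) := by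
  have hL := hh.nonneg
  have hθ : 0 < σhi / σlo := div_pos (hσlo.trans hσ) hσlo
  obtain ⟨R, hR⟩ : ∃ R : ℝ, ∀ x ∈ Ω, |x| ≤ R := by
    obtain ⟨R, hR⟩ := (Ω.image fun x => |x|).finite_toSet.bddAbove
    exact ⟨R, fun x hx => hR (by simpa using ⟨x, hx, rfl⟩)⟩
  rw [Metric.tendsto_atTop]
  intro ε hε
  obtain ⟨δ, hδ, hδε⟩ : ∃ δ > 0, σhi / σlo * (2 * L * δ) ≤ ε / 4 := by
    refine ⟨ε / (8 * (σhi / σlo * L + 1)), by positivity, ?_⟩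
    rw [show σhi / σlo * (2 * L * (ε / (8 * (σhi / σlo * L + 1)))) =
      ε / 4 * ((σhi / σlo * L) / (σhi / σlo * L + 1)) by field_simp; ring]
    refine mul_le_of_le_one_right (by positivity) ((div_le_one (by positivity)).2 (by linarith))
  obtain ⟨g, g₁, g₂, K, M, hj, hg, hgh, hg₁, hg₂, hM₁, hM₂⟩ := hh.exists_oddJet hδ
  have hheat : ∀ z, |heat 1 g z - heat 1 h z| ≤ 2 * L * δ := fun z =>
    abs_heat_sub_le (integrable_gaussianReal_of_lipschitz hg 1 z)
      (integrable_gaussianReal_of_lipschitz hh.lipschitz 1 z) fun y => hgh _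
  have e1 := abs_glue_sub_le (c := c) hσlo hσ hheat 0
  have e2 := fun n s => abs_expectedUtility_sub_le (B := B)
    (abs_glue_sub_le (c := c) hσlo hσ hgh) n s
  have hlim : Tendsto (fun n : ℕ => stageError σlo σhi K R * (1 / √(n : ℝ))) atTop (𝓝 0) := by
    have := (tendsto_const_nhds (x := (1 : ℝ))).div_atTop
      (Real.tendsto_sqrt_atTop.comp tendsto_natCast_atTop_atTop)
    simpa using this.const_mul (stageError σlo σhi K R)
  obtain ⟨N, hN⟩ := eventually_atTop.1
    (hlim.eventually (gt_mem_nhds (show 0 < ε / 4 by positivity)))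
  refine ⟨N + 1, fun n hn => ?_⟩
  have hnN := hN n (by omega)
  obtain ⟨hup, s, hs⟩ := expectedUtility_glue_bounds (c := c) (n := n) hσlo hσ hB
    (fun τ => ⟨_, _, hj.heat hg hg₁ hg₂ hM₁ hM₂ τ⟩) hg hR (by omega)
  have hlub := isLUB_value hB (glue σlo σhi c h) n
  have u1 : value B (glue σlo σhi c h) n ≤ glue σlo σhi c (heat 1 h) 0 + 3 * (ε / 4) := by
    refine hlub.2 ?_
    rintro _ ⟨t, rfl⟩
    linarith [hup t, (abs_le.1 (e2 n t)).1, (abs_le.1 e1).2]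
  have u2 : expectedUtility B (glue σlo σhi c h) n s ≤ value B (glue σlo σhi c h) n :=
    hlub.1 ⟨s, rfl⟩
  rw [Real.dist_eq, abs_lt]
  constructor <;> linarith [(abs_le.1 (e2 n s)).2, (abs_le.1 e1).1]

end Value

/-! ### Strict loss from noise -/

/-- Strict concavity on `[0, ∞)` makes noise strictly harmful at every `a > 0`. -/
theorem OddConcave.heat_lt {h : ℝ → ℝ} {L : ℝ} (hh : OddConcave h L) {a : ℝ} (ha : 0 < a) :
    heat 1 h a < h a := by
  have i1 := integrable_gaussianReal_of_lipschitz hh.lipschitz 1 a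
  have e : ∀ y, h (a - y) = -h (-a + y) := fun y => by
    rw [← hh.odd]
    ring_nf
  have i2 : Integrable (fun y => h (a - y)) (gaussianReal 0 1) := by
    simp only [e]
    exact (integrable_gaussianReal_of_lipschitz hh.lipschitz 1 (-a)).neg
  have h2 : ∫ y, h (a - y) ∂(gaussianReal 0 1) = heat 1 h a := by
    simp only [e, integral_neg]
    rw [← neg_neg (heat 1 h a), ← heat_neg hh.odd]
    rfl
  have i3 : Integrable (fun y => h (a + y) + h (a - y)) (gaussianReal 0 1) := i1.add i2
  have h3 : ∫ y, (2 * h a - (h (a + y) + h (a - y))) ∂(gaussianReal 0 1) =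
      2 * h a - 2 * heat 1 h a := by
    rw [integral_sub (integrable_const _) i3, integral_add i1 i2, h2, integral_const]
    simp only [probReal_univ, one_smul, heat]
    ring
  have h4 : 0 < ∫ y, (2 * h a - (h (a + y) + h (a - y))) ∂(gaussianReal 0 1) := by
    rw [integral_pos_iff_support_of_nonneg
      (fun y => sub_nonneg.2 (hh.add_sub_le_two_mul ha.le y)) ((integrable_const _).sub i3)]
    have hsub : ({0}ᶜ : Set ℝ) ⊆
        Function.support fun y => 2 * h a - (h (a + y) + h (a - y)) := fun y hy =>
      (sub_pos.2 (hh.add_sub_lt_two_mul ha hy)).ne'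
    have : NullSingletonClass (gaussianReal 0 1) := nullSingletonClass_gaussianReal one_ne_zero
    refine lt_of_lt_of_le ?_ (measure_mono hsub)
    rw [measure_compl (measurableSet_singleton 0) (measure_ne_top _ _), measure_singleton]
    simp
  linarith

/-! ### The limiting density -/

section Pieces

/-- The function given by the profile `G₁` above `c` and `G₂` below `c`, each in its normalized
coordinate and normalized as a density. -/
noncomputable def pieces (σlo σhi c : ℝ) (G₁ G₂ : ℝ → ℝ) (y : ℝ) : ℝ :=
  if c ≤ y then σlo⁻¹ * G₁ ((y - c) / σlo) else σhi⁻¹ * G₂ ((y - c) / σhi)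

theorem integral_inv_mul_comp_sub_div {σ : ℝ} (hσ : 0 < σ) (c : ℝ) (G : ℝ → ℝ) :
    ∫ y, σ⁻¹ * G ((y - c) / σ) = ∫ z, G z := by
  rw [integral_const_mul, integral_sub_right_eq_self (fun y => G (y / σ)) c,
    Measure.integral_comp_div, abs_of_pos hσ, smul_eq_mul, inv_mul_cancel_left₀ hσ.ne']

theorem integrable_inv_mul_comp_sub_div {σ : ℝ} (hσ : 0 < σ) (c : ℝ) {G : ℝ → ℝ}
    (hG : Integrable G) : Integrable fun y => σ⁻¹ * G ((y - c) / σ) :=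
  ((hG.comp_div hσ.ne').comp_sub_right c).const_mul _

variable {σlo σhi : ℝ}

theorem pieces_eq_add (hσlo : 0 < σlo) (hσhi : 0 < σhi) (c : ℝ) (G₁ G₂ : ℝ → ℝ) (y : ℝ) :
    pieces σlo σhi c G₁ G₂ y = σlo⁻¹ * (Set.Ici 0).indicator G₁ ((y - c) / σlo)
      + σhi⁻¹ * (Set.Iio 0).indicator G₂ ((y - c) / σhi) := by
  have h1 : (y - c) / σlo ∈ Set.Ici (0 : ℝ) ↔ c ≤ y := by
    rw [Set.mem_Ici, le_div_iff₀ hσlo, zero_mul, sub_nonneg]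
  have h2 : (y - c) / σhi ∈ Set.Iio (0 : ℝ) ↔ ¬c ≤ y := by
    rw [Set.mem_Iio, div_lt_iff₀ hσhi, zero_mul, sub_neg, not_le]
  by_cases hy : c ≤ y
  · rw [pieces, if_pos hy, Set.indicator_of_mem (h1.2 hy),
      Set.indicator_of_notMem (fun h => h2.1 h hy), mul_zero, add_zero]
  · rw [pieces, if_neg hy, Set.indicator_of_notMem (fun h => hy (h1.1 h)),
      Set.indicator_of_mem (h2.2 hy), mul_zero, zero_add]

variable {G₁ G₂ : ℝ → ℝ}

theorem integrable_pieces (hσlo : 0 < σlo) (hσhi : 0 < σhi) (c : ℝ)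
    (h₁ : Integrable G₁) (h₂ : Integrable G₂) : Integrable (pieces σlo σhi c G₁ G₂) := by
  rw [funext (pieces_eq_add hσlo hσhi c G₁ G₂)]
  exact (integrable_inv_mul_comp_sub_div hσlo c (h₁.indicator measurableSet_Ici)).add
    (integrable_inv_mul_comp_sub_div hσhi c (h₂.indicator measurableSet_Iio))

/-- Both branches, rescaled and folded onto the half-line `(0, ∞)`. -/
theorem integral_pieces (hσlo : 0 < σlo) (hσhi : 0 < σhi) (c : ℝ)
    (h₁ : Integrable G₁) (h₂ : Integrable G₂) :
    ∫ y, pieces σlo σhi c G₁ G₂ y = ∫ z in Set.Ioi 0, (G₁ z + G₂ (-z)) := by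
  rw [funext (pieces_eq_add hσlo hσhi c G₁ G₂), integral_add
    (integrable_inv_mul_comp_sub_div hσlo c (h₁.indicator measurableSet_Ici))
    (integrable_inv_mul_comp_sub_div hσhi c (h₂.indicator measurableSet_Iio)),
    integral_inv_mul_comp_sub_div hσlo, integral_inv_mul_comp_sub_div hσhi,
    integral_indicator measurableSet_Ici, integral_indicator measurableSet_Iio,
    integral_Ici_eq_integral_Ioi, integral_add h₁.integrableOn h₂.comp_neg.integrableOn,
    integral_comp_neg_Ioi, neg_zero, integral_Iic_eq_integral_Iio]

theorem integral_eq_integral_Ioi_add_neg {G : ℝ → ℝ} (hG : Integrable G) :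
    ∫ z, G z = ∫ z in Set.Ioi 0, (G z + G (-z)) := by
  rw [← integral_pieces one_pos one_pos 0 hG hG]
  simp [pieces]

end Pieces

theorem gaussianPDFReal_neg_neg (m z : ℝ) :
    gaussianPDFReal (-m) 1 (-z) = gaussianPDFReal m 1 z := by
  unfold gaussianPDFReal
  ring_nf

theorem gaussianPDFReal_neg_right (m z : ℝ) :
    gaussianPDFReal m 1 (-z) = gaussianPDFReal (-m) 1 z := by
  rw [← gaussianPDFReal_neg_neg, neg_neg]

theorem integral_gaussianReal_eq_heat (h : ℝ → ℝ) (m : ℝ) :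
    ∫ z, h z * gaussianPDFReal m 1 z = heat 1 h m := by
  have h1 : (gaussianReal 0 1).map (m + ·) = gaussianReal m 1 := by
    rw [gaussianReal_map_const_add, zero_add]
  calc ∫ z, h z * gaussianPDFReal m 1 z = ∫ z, h z ∂(gaussianReal m 1) := by
        rw [integral_gaussianReal_eq_integral_smul one_ne_zero]
        simp only [smul_eq_mul, mul_comm]
    _ = ∫ z, h z ∂((gaussianReal 0 1).map (m + ·)) := by rw [h1]
    _ = heat 1 h m := (MeasurableEquiv.addLeft m).measurableEmbedding.integral_map _

theorem integrable_mul_gaussianPDFReal {h : ℝ → ℝ} {L : ℝ}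
    (hh : ∀ x y, |h x - h y| ≤ L * |x - y|) (m : ℝ) :
    Integrable fun z => h z * gaussianPDFReal m 1 z := by
  have h1 : (gaussianReal 0 1).map (m + ·) = gaussianReal m 1 := by
    rw [gaussianReal_map_const_add, zero_add]
  have h2 : Integrable h (gaussianReal m 1) := by
    rw [← h1]
    exact ((MeasurableEquiv.addLeft m).measurableEmbedding.integrable_map_iff).2
      (integrable_gaussianReal_of_lipschitz hh 1 m)
  rw [gaussianReal_of_var_ne_zero _ one_ne_zero, integrable_withDensity_iff
    (measurable_gaussianPDF _ _) (Eventually.of_forall fun _ => ENNReal.ofReal_lt_top)] at h2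
  simpa only [toReal_gaussianPDF] using h2

/-- For odd `h`, the normal density shifted by `m` acts on the half-line as a difference of
reflected densities. -/
theorem integral_Ioi_mul_gaussianPDFReal_sub {h : ℝ → ℝ} {L : ℝ} (hh : OddConcave h L) (m : ℝ) :
    ∫ z in Set.Ioi 0, h z * (gaussianPDFReal m 1 z - gaussianPDFReal (-m) 1 z) = heat 1 h m := by
  rw [← integral_gaussianReal_eq_heat,
    integral_eq_integral_Ioi_add_neg (integrable_mul_gaussianPDFReal hh.lipschitz m)]
  congr with z
  rw [hh.odd, gaussianPDFReal_neg_right]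
  ring

theorem integral_Ioi_gaussianPDFReal_add (m : ℝ) :
    ∫ z in Set.Ioi 0, (gaussianPDFReal m 1 z + gaussianPDFReal (-m) 1 z) = 1 := by
  rw [← integral_gaussianPDFReal_eq_one m one_ne_zero,
    integral_eq_integral_Ioi_add_neg (integrable_gaussianPDFReal m 1)]
  simp only [gaussianPDFReal_neg_right]

section LimitDensity

variable {σlo σhi c : ℝ}

/-- For `c ≥ 0` the start `0` lies below the threshold, at the normalized position
`m = -c / σhi`; `κ = (σhi - σlo) / (σlo + σhi)` is the reflection coefficient. -/
theorem limitDensity_of_nonneg (hc : 0 ≤ c) :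
    limitDensity σlo σhi c = pieces σlo σhi c
      (fun z => (1 + (σhi - σlo) / (σlo + σhi)) * gaussianPDFReal (-c / σhi) 1 z)
      (fun z => gaussianPDFReal (-c / σhi) 1 z
        - (σhi - σlo) / (σlo + σhi) * gaussianPDFReal (-(-c / σhi)) 1 z) := by
  funext y
  have e1 : ∀ z, -(-c / σhi - z) ^ 2 / 2 = -(z - -c / σhi) ^ 2 / 2 := fun z => by ring
  have e2 : ∀ z, -(c / σhi + z) ^ 2 / 2 = -(z - -c / σhi) ^ 2 / 2 := fun z => by ring
  have e3 : -((c - y) / σhi - -c / σhi) ^ 2 / 2 =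
      -((y - c) / σhi - -(-c / σhi)) ^ 2 / 2 := by ring
  simp only [limitDensity, pieces, if_pos hc, gaussianPDFReal, NNReal.coe_one, mul_one, e1, e2, e3,
    one_div, mul_inv]
  split_ifs <;> ring

/-- For `c < 0` the start `0` lies above the threshold, at the normalized position
`m = -c / σlo`. -/
theorem limitDensity_of_neg (hc : c < 0) :
    limitDensity σlo σhi c = pieces σlo σhi c
      (fun z => gaussianPDFReal (-c / σlo) 1 z
        + (σhi - σlo) / (σlo + σhi) * gaussianPDFReal (-(-c / σlo)) 1 z)
      (fun z => (1 - (σhi - σlo) / (σlo + σhi)) * gaussianPDFReal (-c / σlo) 1 z) := by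
  funext y
  have e1 : ∀ z, -(-c / σlo - z) ^ 2 / 2 = -(z - -c / σlo) ^ 2 / 2 := fun z => by ring
  have e2 : ∀ z, -(-c / σlo + z) ^ 2 / 2 = -(z - -(-c / σlo)) ^ 2 / 2 := fun z => by ring
  have e3 : -((c - y) / σhi - -(-c / σlo)) ^ 2 / 2 = -((y - c) / σhi - -c / σlo) ^ 2 / 2 := by
    ring
  simp only [limitDensity, pieces, if_neg (not_le.2 hc), gaussianPDFReal, NNReal.coe_one, mul_one,
    e1, e2, e3, one_div, mul_inv]
  split_ifs <;> ring

theorem limitDensity_nonneg (hσlo : 0 < σlo) (hσ : σlo < σhi) (c y : ℝ) :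
    0 ≤ limitDensity σlo σhi c y := by
  have hσhi : 0 < σhi := hσlo.trans hσ
  have hκ0 : 0 ≤ (σhi - σlo) / (σlo + σhi) := div_nonneg (by linarith) (by linarith)
  have hκ1 : (σhi - σlo) / (σlo + σhi) ≤ 1 := (div_le_one (by linarith)).2 (by linarith)
  have hp := gaussianPDFReal_nonneg
  rcases le_or_gt 0 c with hc | hc
  · rw [limitDensity_of_nonneg hc, pieces]
    split_ifs with hy
    · have := hp (-c / σhi) 1 ((y - c) / σlo)
      positivity
    · refine mul_nonneg (by positivity) (sub_nonneg.2 ?_)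
      refine (mul_le_of_le_one_left (hp _ _ _) hκ1).trans ?_
      have h1 : 0 ≤ (-c / σhi) * ((y - c) / σhi) :=
        mul_nonneg_of_nonpos_of_nonpos (div_nonpos_of_nonpos_of_nonneg (by linarith) hσhi.le)
          (div_nonpos_of_nonpos_of_nonneg (by linarith) hσhi.le)
      have := gaussianPDFReal_add_le_sub (τ := 1) h1
      simpa [gaussianPDFReal] using this
  · rw [limitDensity_of_neg hc, pieces]
    split_ifs with hy
    · have h1 := hp (-c / σlo) 1 ((y - c) / σlo)
      have h2 := hp (-(-c / σlo)) 1 ((y - c) / σlo)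
      positivity
    · exact mul_nonneg (by positivity) (mul_nonneg (by linarith) (hp _ _ _))

theorem integrable_limitDensity (hσlo : 0 < σlo) (hσ : σlo < σhi) (c : ℝ) :
    Integrable (limitDensity σlo σhi c) := by
  have hσhi : 0 < σhi := hσlo.trans hσ
  have hp := fun m => integrable_gaussianPDFReal m 1
  rcases le_or_gt 0 c with hc | hc
  · rw [limitDensity_of_nonneg hc]
    exact integrable_pieces hσlo hσhi c ((hp _).const_mul _) ((hp _).sub ((hp _).const_mul _))
  · rw [limitDensity_of_neg hc]
    exact integrable_pieces hσlo hσhi c ((hp _).add ((hp _).const_mul _)) ((hp _).const_mul _)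

theorem integral_limitDensity (hσlo : 0 < σlo) (hσ : σlo < σhi) (c : ℝ) :
    ∫ y, limitDensity σlo σhi c y = 1 := by
  have hσhi : 0 < σhi := hσlo.trans hσ
  have hp := fun m => integrable_gaussianPDFReal m 1
  rcases le_or_gt 0 c with hc | hc
  · rw [limitDensity_of_nonneg hc]
    refine (integral_pieces hσlo hσhi c ((hp _).const_mul _)
      ((hp _).sub ((hp _).const_mul _))).trans
      (Eq.trans ?_ (integral_Ioi_gaussianPDFReal_add (-c / σhi)))
    congr with z
    simp only [Pi.sub_apply]
    rw [gaussianPDFReal_neg_neg, gaussianPDFReal_neg_right]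
    ring
  · rw [limitDensity_of_neg hc]
    refine (integral_pieces hσlo hσhi c ((hp _).add ((hp _).const_mul _))
      ((hp _).const_mul _)).trans (Eq.trans ?_ (integral_Ioi_gaussianPDFReal_add (-c / σlo)))
    congr with z
    simp only [Pi.add_apply]
    rw [gaussianPDFReal_neg_right]
    ring

theorem glue_mul_pieces (σlo σhi c : ℝ) (h G₁ G₂ : ℝ → ℝ) (y : ℝ) :
    glue σlo σhi c h y * pieces σlo σhi c G₁ G₂ y =
      pieces σlo σhi c (fun z => h z * G₁ z) (fun z => σhi / σlo * (h z * G₂ z)) y := by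
  unfold glue pieces
  split_ifs <;> ring

/-- Integrating the glued profile against the limiting density gives the glued heat flow at the
start: after folding onto the half-line, the reflection coefficient combines with the slope ratio
`σhi / σlo` to leave the odd kernel of the heat flow. -/
theorem integrable_and_integral_glue_mul_limitDensity (hσlo : 0 < σlo) (hσ : σlo < σhi) {h : ℝ → ℝ}
    {L : ℝ} (hh : OddConcave h L) (c : ℝ) :
    Integrable (fun y => glue σlo σhi c h y * limitDensity σlo σhi c y) ∧
      ∫ y, glue σlo σhi c h y * limitDensity σlo σhi c y = glue σlo σhi c (heat 1 h) 0 := by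
  have hσhi : 0 < σhi := hσlo.trans hσ
  have hp := integrable_mul_gaussianPDFReal hh.lipschitz
  rcases le_or_gt 0 c with hc | hc
  · have i1 : Integrable fun z =>
        h z * ((1 + (σhi - σlo) / (σlo + σhi)) * gaussianPDFReal (-c / σhi) 1 z) := by
      simp only [mul_left_comm (h _)]
      exact (hp _).const_mul _
    have i2 : Integrable fun z => σhi / σlo * (h z * (gaussianPDFReal (-c / σhi) 1 z
        - (σhi - σlo) / (σlo + σhi) * gaussianPDFReal (-(-c / σhi)) 1 z)) := by
      simp only [mul_sub (h _), mul_left_comm (h _)]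
      exact ((hp _).sub ((hp _).const_mul _)).const_mul _
    rw [limitDensity_of_nonneg hc]
    simp only [glue_mul_pieces]
    refine ⟨integrable_pieces hσlo hσhi c i1 i2, ?_⟩
    rw [integral_pieces hσlo hσhi c i1 i2]
    have e : ∀ z, h z * ((1 + (σhi - σlo) / (σlo + σhi)) * gaussianPDFReal (-c / σhi) 1 z)
        + σhi / σlo * (h (-z) * (gaussianPDFReal (-c / σhi) 1 (-z)
          - (σhi - σlo) / (σlo + σhi) * gaussianPDFReal (-(-c / σhi)) 1 (-z)))
        = σhi / σlo * (h z *
          (gaussianPDFReal (-c / σhi) 1 z - gaussianPDFReal (-(-c / σhi)) 1 z)) := by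
      intro z
      rw [gaussianPDFReal_neg_neg, gaussianPDFReal_neg_right, hh.odd]
      field_simp
      ring
    simp only [e]
    rw [integral_const_mul, integral_Ioi_mul_gaussianPDFReal_sub hh, glue]
    split_ifs with hc'
    · obtain rfl : c = 0 := le_antisymm hc' hc
      simp [eq_zero_of_odd (heat_neg hh.odd 1)]
    · rw [zero_sub]
  · have i1 : Integrable fun z => h z * (gaussianPDFReal (-c / σlo) 1 z
        + (σhi - σlo) / (σlo + σhi) * gaussianPDFReal (-(-c / σlo)) 1 z) := by
      simp only [mul_add (h _), mul_left_comm (h _)]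
      exact (hp _).add ((hp _).const_mul _)
    have i2 : Integrable fun z => σhi / σlo * (h z *
        ((1 - (σhi - σlo) / (σlo + σhi)) * gaussianPDFReal (-c / σlo) 1 z)) := by
      simp only [mul_left_comm (h _)]
      exact ((hp _).const_mul _).const_mul _
    rw [limitDensity_of_neg hc]
    simp only [glue_mul_pieces]
    refine ⟨integrable_pieces hσlo hσhi c i1 i2, ?_⟩
    rw [integral_pieces hσlo hσhi c i1 i2]
    have e : ∀ z, h z * (gaussianPDFReal (-c / σlo) 1 z
          + (σhi - σlo) / (σlo + σhi) * gaussianPDFReal (-(-c / σlo)) 1 z)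
        + σhi / σlo * (h (-z) *
          ((1 - (σhi - σlo) / (σlo + σhi)) * gaussianPDFReal (-c / σlo) 1 (-z)))
        = h z * (gaussianPDFReal (-c / σlo) 1 z - gaussianPDFReal (-(-c / σlo)) 1 z) := by
      intro z
      rw [gaussianPDFReal_neg_right, hh.odd]
      field_simp
      ring
    simp only [e]
    rw [integral_Ioi_mul_gaussianPDFReal_sub hh, glue, if_pos hc.le, zero_sub]

theorem limitDensity_zero (hσlo : 0 < σlo) (hσ : σlo < σhi) (y : ℝ) :
    limitDensity σlo σhi 0 y =
      if 0 ≤ y then normalDensity σlo y * (2 * σhi / (σlo + σhi))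
      else normalDensity σhi y * (2 * σlo / (σlo + σhi)) := by
  have hσhi : 0 < σhi := hσlo.trans hσ
  have e : ∀ σ, -(-(y / σ)) ^ 2 / 2 = -(y / σ) ^ 2 / 2 := fun σ => by ring
  have e' : -(-y / σhi) ^ 2 / 2 = -(y / σhi) ^ 2 / 2 := by ring
  simp only [limitDensity, le_refl, if_true, normalDensity, neg_zero, zero_div, sub_zero, zero_sub,
    zero_add, e, e']
  have : 0 < √(2 * Real.pi) := by positivity
  split_ifs
  · field_simp
    ring
  · field_simp
    ring

end LimitDensity

theorem utilityIndex_eq_glue {σlo σhi : ℝ} (hσlo : 0 < σlo) (hσ : σlo < σhi) (φ₁ : ℝ → ℝ)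
    (c : ℝ) :
    utilityIndex φ₁ (σlo / σhi) c = glue σlo σhi c (oddExtension fun z => φ₁ (σlo * z)) := by
  have hσhi : 0 < σhi := hσlo.trans hσ
  funext x
  unfold utilityIndex glue
  split_ifs with hx
  · rw [oddExtension, if_pos (div_nonneg (by linarith) hσlo.le), mul_div_cancel₀ _ hσlo.ne']
  · rw [oddExtension, if_neg (not_le.2 (div_neg_of_neg_of_pos (by linarith) hσhi)), inv_div]
    have : -(σlo / σhi) * (x - c) = σlo * -((x - c) / σhi) := by ring
    rw [this]
    ring

/-! ### The limit theorem -/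

theorem theorem1 {A : Type*} [Finite A] (Ω : Finset ℝ) (σlo σhi : ℝ)
    (hσlo : 0 < σlo) (hσ : σlo < σhi)
    (B : Beliefs A Ω) (hB : B.Admissible σlo σhi)
    (φ₁ : ℝ → ℝ) (hφ₁ : IsGainFunction φ₁) (c : ℝ)
    (φ : ℝ → ℝ) (hφ : φ = utilityIndex φ₁ (σlo / σhi) c)
    (q : ℝ → ℝ) (hq : q = limitDensity σlo σhi c) :
    -- the `n`-horizon value is a genuine (finite) supremum
    (∀ n : ℕ, IsLUB (Set.range (expectedUtility B φ n)) (value B φ n)) ∧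
    -- `q` is a probability density against which `φ` is integrable
    (∀ y, 0 ≤ q y) ∧ Integrable q ∧ ∫ y, q y = 1 ∧ Integrable (fun y => φ y * q y) ∧
    -- simple form of the density for `c = 0`
    (c = 0 → ∀ y, q y =
      if 0 ≤ y then normalDensity σlo y * (2 * σhi / (σlo + σhi))
      else normalDensity σhi y * (2 * σlo / (σlo + σhi))) ∧
    ∃ V : ℝ,
      -- (i) the values converge to the integral
      Tendsto (fun n => value B φ n) atTop (𝓝 V) ∧ V = ∫ y, φ y * q y ∧
      -- (ii) any other beliefs with the same variance extremes have the same limiting value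
      (∀ B' : Beliefs A Ω, B'.Admissible σlo σhi →
        Tendsto (fun n => value B' φ n) atTop (𝓝 V)) ∧
      -- (iii) comparison with the utility of zero for sure
      (c = 0 → V = φ 0) ∧ (0 < c → φ 0 < V) ∧ (c < 0 → V < φ 0) := by
  obtain ⟨L, hh⟩ := oddConcave_oddExtension hφ₁ hσlo
  rw [utilityIndex_eq_glue hσlo hσ] at hφ
  set h := oddExtension fun z => φ₁ (σlo * z)
  subst hφ hq
  have hσhi : 0 < σhi := hσlo.trans hσ
  obtain ⟨hint, hV⟩ := integrable_and_integral_glue_mul_limitDensity hσlo hσ hh c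
  refine ⟨isLUB_value hB _, limitDensity_nonneg hσlo hσ c, integrable_limitDensity hσlo hσ c,
    integral_limitDensity hσlo hσ c, hint, ?_, glue σlo σhi c (heat 1 h) 0,
    tendsto_value_glue hσlo hσ hB hh c, hV.symm,
    fun B' hB' => tendsto_value_glue hσlo hσ hB' hh c, ?_, ?_, ?_⟩
  · rintro rfl
    exact limitDensity_zero hσlo hσ
  · rintro rfl
    simp [glue, eq_zero_of_odd hh.odd, eq_zero_of_odd (heat_neg hh.odd 1)]
  · intro hc
    have := hh.heat_lt (div_pos hc hσhi)
    rw [glue, glue, if_neg (not_le.2 hc), if_neg (not_le.2 hc), zero_sub, neg_div,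
      heat_neg hh.odd, hh.odd]
    exact mul_lt_mul_of_pos_left (neg_lt_neg this) (div_pos hσhi hσlo)
  · intro hc
    rw [glue, glue, if_pos hc.le, if_pos hc.le, zero_sub]
    exact hh.heat_lt (div_pos (neg_pos.2 hc) hσlo)
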